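/- Let $d$ be a dimension and $\lambda$ Lebesgue measure on $\mathbb R^d$. A \emph{sum of open sets} is a binary operation $\oplus$ assigning to any two bounded open sets $A,B\subseteq\mathbb R^d$ an open (possibly unbounded) set $A\oplus B\subseteq\mathbb R^d$. Suppose that $\oplus$ satisfies, for all bounded open $A,B,C\subseteq\mathbb R^d$: \begin{enumerate} \item (monotonicity) $A\subseteq A\oplus B$, and if $A\subseteq B$ then $A\oplus C\subseteq B\oplus C$; \item (commutativity) $A\oplus B=B\oplus A$; \item (associativity) if $A\oplus B$ and $B\oplus C$ are bounded, then $(A\oplus B)\oplus C=A\oplus(B\oplus C)$; \item (translation invariance) $(A+x)\oplus(B+x)=(A\oplus B)+x$ for every $x\in\mathbb R^d$; \item (rotation invariance) $(UA)\oplus(UB)=U(A\oplus B)$ for every $U\in O(d)$ that maps the cube $[-1,1]^d$ onto itself; \item (conservation of measure) $\lambda(A\oplus B)=\lambda(A)+\lambda(B)$; \item (bulkiness) $A\oplus B$ contains every open set $V$ with $\lambda(V\,\triangle\,(A\oplus B))=0$. \end{enumerate} A function $s:Q\to(-\infty,\infty]$ on an open set $Q\subseteq\mathbb R^d$ is \emph{superharmonic}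 on $Q$ if it is locally integrable and lower semicontinuous on $Q$ and, for every $x\in Q$, $\frac1{\lambda(B_r(x))}\int_{B_r(x)}s\,dy\le s(x)$ for all sufficiently small $r>0$. A \emph{quadrature domain} for a bounded measurable function $w\ge0$ is an open set $Q$ with $\lambda(\{w>0\}\setminus Q)=0$ such that $\int_Q s\,dx\le\int_Q sw\,dx$ for every $s$ that is superharmonic and integrable on $Q$. Then for all bounded open sets $A,B\subseteq\mathbb R^d$, $$\int_{A\oplus B}s\,dx\le\int_A s\,dx+\int_B s\,dx$$ for every superharmonic function $s$ on $A\oplus B$ that is integrable on $A\oplus B$; in other words, $A\oplus B$ is a quadrature domain for $\mathbf 1_A+\mathbf 1_B$. -/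

import Mathlib

open MeasureTheory Topology

namespace SmashSum

/-- The Euclidean space `ℝ^d`. -/
abbrev Space (d : ℕ) : Type := EuclideanSpace ℝ (Fin d)

/-- A sum of open sets: a binary operation that takes two bounded open subsets of `ℝ^d` to an
open, possibly unbounded, subset of `ℝ^d`. The operation is written as a total function on sets;
here and in everything below only its values at bounded open sets play a role. -/
def IsSumOfOpenSets {d : ℕ} (op : Set (Space d) → Set (Space d) → Set (Space d)) : Prop :=
  ∀ A B : Set (Space d), IsOpen A → Bornology.IsBounded A → IsOpen B → Bornology.IsBounded B →
    IsOpen (op A B)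

/-- The cube `[-1, 1]^d`. -/
def cube (d : ℕ) : Set (Space d) := {x | ∀ i, |x i| ≤ 1}

/-- A cubic isometry: an element of `O(d)` that maps the cube onto itself. -/
def IsCubicIsometry {d : ℕ} (U : Space d ≃ₗᵢ[ℝ] Space d) : Prop :=
  U '' cube d = cube d

/-- The six requirements on a sum of open sets. -/
structure SatisfiesSixRequirements {d : ℕ}
    (op : Set (Space d) → Set (Space d) → Set (Space d)) : Prop where
  /-- Monotonicity, first part. -/
  subset_sum : ∀ A B : Set (Space d),
    IsOpen A → Bornology.IsBounded A → IsOpen B → Bornology.IsBounded B → A ⊆ op A B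
  /-- Monotonicity, second part. -/
  mono : ∀ A B C : Set (Space d),
    IsOpen A → Bornology.IsBounded A → IsOpen B → Bornology.IsBounded B →
    IsOpen C → Bornology.IsBounded C → A ⊆ B → op A C ⊆ op B C
  /-- Commutativity. -/
  comm : ∀ A B : Set (Space d),
    IsOpen A → Bornology.IsBounded A → IsOpen B → Bornology.IsBounded B → op A B = op B A
  /-- Associativity when it makes sense. -/
  assoc : ∀ A B C : Set (Space d),
    IsOpen A → Bornology.IsBounded A → IsOpen B → Bornology.IsBounded B →
    IsOpen C → Bornology.IsBounded C →
    Bornology.IsBounded (op A B) → Bornology.IsBounded (op B C) →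
    op (op A B) C = op A (op B C)
  /-- Translation invariance. -/
  translation : ∀ (A B : Set (Space d)) (x : Space d),
    IsOpen A → Bornology.IsBounded A → IsOpen B → Bornology.IsBounded B →
    op ((fun a => a + x) '' A) ((fun b => b + x) '' B) = (fun c => c + x) '' op A B
  /-- Invariance under cubic isometries. -/
  rotation : ∀ (A B : Set (Space d)) (U : Space d ≃ₗᵢ[ℝ] Space d),
    IsOpen A → Bornology.IsBounded A → IsOpen B → Bornology.IsBounded B →
    IsCubicIsometry U → op (U '' A) (U '' B) = U '' op A B
  /-- Conservation of measure. -/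
  conservation : ∀ A B : Set (Space d),
    IsOpen A → Bornology.IsBounded A → IsOpen B → Bornology.IsBounded B →
    volume (op A B) = volume A + volume B

/-- A set is bulky if it is open and contains every open set that is essentially equal to it
(that is, whose symmetric difference with it is a Lebesgue null set). -/
def IsBulky {d : ℕ} (U : Set (Space d)) : Prop :=
  IsOpen U ∧ ∀ V : Set (Space d), IsOpen V → volume (symmDiff V U) = 0 → V ⊆ U

/-- Bulkiness of a sum of open sets: the sum of any two bounded open sets is bulky. -/
def IsBulkySum {d : ℕ} (op : Set (Space d) → Set (Space d) → Set (Space d)) : Prop :=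
  ∀ A B : Set (Space d), IsOpen A → Bornology.IsBounded A → IsOpen B → Bornology.IsBounded B →
    IsBulky (op A B)

/-- Superharmonic functions on an open set `Q`, with values in `(-∞, ∞]`: locally integrable on
`Q` (in particular finite almost everywhere on `Q`), lower semicontinuous on `Q`, and at each
`x ∈ Q` at least as large as the average over `B_r(x)` for all sufficiently small `r > 0`.
Values of `s` outside `Q` are irrelevant. -/
structure IsSuperharmonicOn {d : ℕ} (s : Space d → EReal) (Q : Set (Space d)) : Prop where
  ne_bot : ∀ x ∈ Q, s x ≠ ⊥
  ae_ne_top : ∀ᵐ x ∂(volume.restrict Q), s x ≠ ⊤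
  locallyIntegrableOn : LocallyIntegrableOn (fun x => (s x).toReal) Q volume
  lowerSemicontinuousOn : LowerSemicontinuousOn s Q
  average_le : ∀ x ∈ Q, ∀ᶠ r : ℝ in 𝓝[>] 0,
    ((⨍ y in Metric.ball x r, (s y).toReal : ℝ) : EReal) ≤ s x

/-- A quadrature domain for a bounded measurable weight `w ≥ 0`: an open set `Q` that essentially
contains `{w > 0}` and satisfies `∫_Q s ≤ ∫ s w` for every function `s` that is superharmonic and
integrable on `Q`. As `s` is a function on `Q` and `w` vanishes almost everywhere outside `Q`, the
second integral is taken over `Q`. -/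
def IsQuadratureDomain {d : ℕ} (w : Space d → ℝ) (Q : Set (Space d)) : Prop :=
  IsOpen Q ∧ volume ({x | 0 < w x} \ Q) = 0 ∧
    ∀ s : Space d → EReal, IsSuperharmonicOn s Q →
      IntegrableOn (fun x => (s x).toReal) Q volume →
      ∫ x in Q, (s x).toReal ≤ ∫ x in Q, (s x).toReal * w x

end SmashSum

/-! ### Elementary consequences of the axioms; sums of balls stay bounded -/

namespace SmashSum

open Filter Set Metric Bornology

variable {d : ℕ} {op : Set (Space d) → Set (Space d) → Set (Space d)}

/-! For disjoint sets, monotonicity and conservation of measure force the sum to be the union up to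
a null set. With associativity, the second summand can therefore be added piece by piece, and
everything reduces to adding a tiny ball `C` centred at `z` to a set `W`.

If `W` were the ball `B` of radius `r` about `z`, the new mass `E = (B ⊕ C) \ B` would be invariant
under the cubic isometries about `z`. These kill the linear Taylor term and make the second moments
isotropic. Since `E` avoids `B` and stays within distance `K * r` of `z`
(`IsSmash.exists_op_ball_subset`), a smooth `g` with Laplacian bounded above by a negative constant
satisfies `∫_E g ≤ |C| (g z - γ)` for small `r`.

General `W` is handled by a bootstrap on the inequality with error `M * |X|`, which is trivial for
`M = 2 sup |g|`. By `IsSmash.setIntegral_op_le_overlap` the error is charged only to the overlap of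
the summands. In `IsSmash.setIntegral_op_ball_le`, `C` is first added to the part of `W` inside `B`.
The mass produced either overlaps the outer part of `W`, hence lies in `E` and costs `M`, or is
compared with the rest of `E` by the Lipschitz bound, which costs at most `M` as long as `M` is not
small compared with `r`. The gap of `E` then improves `M` by `γ / 2`. Filling `X` by small balls and
iterating (`IsSmash.quadratureUpTo_sub`) brings `M` down to order `r`, and `r` is arbitrary.

A superharmonic function is reduced to this case by truncation, inf-convolution, subtraction of `κ
‖x‖²` and mollification. Inf-convolution supplies the one-sided quadratic bound that lets the mean
value inequality, whose admissible radii are not uniform, pass through the mollification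
(`trace_convolution_le`). Eroding `A` and `B` leaves room for these operations inside `A ⊕ B`. -/

/-- Bounded open sets. -/
structure IsBddOpen (A : Set (Space d)) : Prop where
  isOpen : IsOpen A
  isBounded : IsBounded A

namespace IsBddOpen

variable {A B : Set (Space d)}

theorem measurableSet (hA : IsBddOpen A) : MeasurableSet A := hA.isOpen.measurableSet

theorem ne_top (hA : IsBddOpen A) : volume A ≠ ⊤ := hA.isBounded.measure_lt_top.ne

theorem union (hA : IsBddOpen A) (hB : IsBddOpen B) : IsBddOpen (A ∪ B) :=
  ⟨hA.isOpen.union hB.isOpen, hA.isBounded.union hB.isBounded⟩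

theorem inter_left (hA : IsBddOpen A) (hB : IsOpen B) : IsBddOpen (A ∩ B) :=
  ⟨hA.isOpen.inter hB, hA.isBounded.subset inter_subset_left⟩

/-- An inclusion of bounded open sets of the same measure is an equality almost everywhere. -/
theorem ae_eq_of_subset (hA : IsBddOpen A) (hB : IsBddOpen B)
    (hs : A ⊆ B) (hm : volume B ≤ volume A) : A =ᵐ[volume] B :=
  ae_eq_of_subset_of_measure_ge hs hm hA.measurableSet.nullMeasurableSet hB.ne_top

theorem diff (hA : IsBddOpen A) (hB : IsClosed B) : IsBddOpen (A \ B) :=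
  ⟨hA.isOpen.sdiff hB, hA.isBounded.subset sdiff_subset⟩

end IsBddOpen

theorem isBddOpen_ball (x : Space d) (r : ℝ) : IsBddOpen (ball x r) :=
  ⟨isOpen_ball, isBounded_ball⟩

theorem measureReal_ball (x : Space d) {t : ℝ} (ht : 0 < t) :
    volume.real (ball x t) = t ^ d * volume.real (ball (0 : Space d) 1) := by
  rw [Measure.real, Measure.addHaar_ball_of_pos volume x ht, ENNReal.toReal_mul,
    ENNReal.toReal_ofReal (by positivity), finrank_euclideanSpace_fin, Measure.real]

theorem measureReal_ball_pos (x : Space d) {t : ℝ} (ht : 0 < t) : 0 < volume.real (ball x t) :=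
  ENNReal.toReal_pos (measure_ball_pos _ _ ht).ne' (isBddOpen_ball _ _).ne_top

theorem isBddOpen_empty : IsBddOpen (∅ : Set (Space d)) := ⟨isOpen_empty, isBounded_empty⟩

/-- The hypotheses on a sum of open sets that are used to prove the quadrature inequality. -/
structure IsSmash (op : Set (Space d) → Set (Space d) → Set (Space d)) : Prop where
  isSum : IsSumOfOpenSets op
  six : SatisfiesSixRequirements op

namespace IsSmash

variable (h : IsSmash op) {A A' B B' C : Set (Space d)}
include h

theorem isOpen (hA : IsBddOpen A) (hB : IsBddOpen B) : IsOpen (op A B) :=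
  h.isSum A B hA.1 hA.2 hB.1 hB.2

theorem comm (hA : IsBddOpen A) (hB : IsBddOpen B) : op A B = op B A :=
  h.six.comm A B hA.1 hA.2 hB.1 hB.2

theorem subset_left (hA : IsBddOpen A) (hB : IsBddOpen B) : A ⊆ op A B :=
  h.six.subset_sum A B hA.1 hA.2 hB.1 hB.2

theorem subset_right (hA : IsBddOpen A) (hB : IsBddOpen B) : B ⊆ op A B :=
  h.comm hA hB ▸ h.subset_left hB hA

theorem union_subset (hA : IsBddOpen A) (hB : IsBddOpen B) : A ∪ B ⊆ op A B :=
  Set.union_subset (h.subset_left hA hB) (h.subset_right hA hB)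

theorem mono_left (hA : IsBddOpen A) (hA' : IsBddOpen A') (hB : IsBddOpen B) (hs : A ⊆ A') :
    op A B ⊆ op A' B :=
  h.six.mono A A' B hA.1 hA.2 hA'.1 hA'.2 hB.1 hB.2 hs

theorem mono_right (hA : IsBddOpen A) (hB : IsBddOpen B) (hB' : IsBddOpen B') (hs : B ⊆ B') :
    op A B ⊆ op A B' := by
  rw [h.comm hA hB, h.comm hA hB']
  exact h.mono_left hB hB' hA hs

theorem mono (hA : IsBddOpen A) (hA' : IsBddOpen A') (hB : IsBddOpen B) (hB' : IsBddOpen B')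
    (hs : A ⊆ A') (ht : B ⊆ B') : op A B ⊆ op A' B' :=
  (h.mono_left hA hA' hB hs).trans (h.mono_right hA' hB hB' ht)

theorem measure (hA : IsBddOpen A) (hB : IsBddOpen B) :
    volume (op A B) = volume A + volume B :=
  h.six.conservation A B hA.1 hA.2 hB.1 hB.2

theorem measureReal (hA : IsBddOpen A) (hB : IsBddOpen B) :
    volume.real (op A B) = volume.real A + volume.real B := by
  simp only [Measure.real, h.measure hA hB, ENNReal.toReal_add hA.ne_top hB.ne_top]

theorem op_ball_translate (x y : Space d) (r s : ℝ) :
    op (ball (x + y) r) (ball (x + y) s) = (fun c => c + y) '' op (ball x r) (ball x s) := by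
  have := h.six.translation (ball x r) (ball x s) y isOpen_ball isBounded_ball isOpen_ball
    isBounded_ball
  rw [← this]
  simp [image_add_right, preimage_add_right_ball, sub_neg_eq_add]

theorem op_ball_zero (z : Space d) (r s : ℝ) :
    op (ball z r) (ball z s) = (fun c => c + z) '' op (ball 0 r) (ball 0 s) := by
  simpa using h.op_ball_translate 0 z r s

theorem image_op_ball (U : Space d ≃ₗᵢ[ℝ] Space d) (hU : IsCubicIsometry U) (r s : ℝ) :
    U '' op (ball 0 r) (ball 0 s) = op (ball 0 r) (ball 0 s) := by
  rw [← h.six.rotation _ _ U isOpen_ball isBounded_ball isOpen_ball isBounded_ball hU]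
  simp

end IsSmash

theorem isCubicIsometry_neg : IsCubicIsometry (LinearIsometryEquiv.neg ℝ : Space d ≃ₗᵢ[ℝ] Space d) := by
  ext x
  constructor
  · rintro ⟨y, hy, rfl⟩ i
    simpa using hy i
  · intro hx
    exact ⟨-x, fun i => by simpa using hx i, by simp⟩

theorem exists_one_add_inv_pow_lt_two (d : ℕ) : ∃ N : ℝ, 0 < N ∧ (1 + N⁻¹) ^ d < 2 := by
  have h1 : Tendsto (fun N : ℝ => (1 + N⁻¹) ^ d) atTop (𝓝 ((1 + 0) ^ d)) :=
    (tendsto_const_nhds.add tendsto_inv_atTop_zero).pow d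
  have h2 : ∀ᶠ N : ℝ in atTop, (1 + N⁻¹) ^ d < 2 := h1.eventually_lt_const (by simp)
  obtain ⟨N, hN, hN'⟩ := (h2.and (eventually_gt_atTop 0)).exists
  exact ⟨N, hN', hN⟩

/-- A far point `y` of the sum comes with its antipode `-y`. Enlarging both summands by `M` adds
whole balls of radius `M` about both points, because all small translates of the original sum are
contained in the new one. For `M` large compared with `r` this exceeds the available measure. -/
theorem IsSmash.exists_op_ball_subset (h : IsSmash op) :
    ∃ K : ℝ, 1 ≤ K ∧ ∀ (z : Space d) (r : ℝ), 0 < r → op (ball z r) (ball z r) ⊆ ball z (K * r) := by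
  obtain ⟨N, hN, hN2⟩ := exists_one_add_inv_pow_lt_two d
  -- With `M = N * r`, a point of norm at least `r + 2 * M` makes the balls of radius `M` about `±y`
  -- disjoint from each other and from the ball of radius `r + M` about `0`. Comparing volumes then
  -- gives `2 * M ^ d ≤ (r + M) ^ d`, which the choice of `N` excludes.
  refine ⟨1 + 2 * N, by linarith, fun z r hr => ?_⟩
  suffices H : op (ball 0 r) (ball 0 r) ⊆ ball (0 : Space d) ((1 + 2 * N) * r) by
    rw [h.op_ball_zero]
    rintro _ ⟨c, hc, rfl⟩
    have := H hc
    simpa using this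
  intro y hy
  by_contra hyK
  have hyn : (1 + 2 * N) * r ≤ ‖y‖ := by simpa using hyK
  set M := N * r with hM
  have hM0 : 0 < M := mul_pos hN hr
  set D := op (ball (0 : Space d) (r + M)) (ball 0 (r + M)) with hD
  have key : ∀ w ∈ op (ball (0 : Space d) r) (ball 0 r), ball w M ⊆ D := by
    intro w hw x hx
    have hsub : ball (0 + (x - w)) r ⊆ ball (0 : Space d) (r + M) := by
      refine ball_subset_ball' ?_
      have : dist (0 + (x - w)) 0 < M := by simpa [dist_eq_norm] using hx
      linarith
    have h1 := h.mono (isBddOpen_ball _ _) (isBddOpen_ball _ _) (isBddOpen_ball _ _)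
      (isBddOpen_ball _ _) hsub hsub
    refine h1 ?_
    rw [h.op_ball_translate]
    exact ⟨w, hw, by simp⟩
  have hy' : -y ∈ op (ball (0 : Space d) r) (ball 0 r) := by
    rw [← h.image_op_ball _ isCubicIsometry_neg]
    exact ⟨y, hy, by simp⟩
  have h3 : ball (0 : Space d) (r + M) ⊆ D := h.subset_left (isBddOpen_ball _ _) (isBddOpen_ball _ _)
  have hd1 : Disjoint (ball y M) (ball (-y) M) := by
    refine ball_disjoint_ball ?_
    have : dist y (-y) = 2 * ‖y‖ := by
      rw [dist_eq_norm, sub_neg_eq_add, ← two_smul ℝ y, norm_smul]; simp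
    rw [this]; nlinarith
  have hd2 : Disjoint (ball y M ∪ ball (-y) M) (ball (0 : Space d) (r + M)) := by
    refine Disjoint.union_left (ball_disjoint_ball ?_) (ball_disjoint_ball ?_)
    · rw [dist_zero_right]; nlinarith
    · rw [dist_zero_right, norm_neg]; nlinarith
  have hle : volume.real ((ball y M ∪ ball (-y) M) ∪ ball (0 : Space d) (r + M)) ≤ volume.real D := by
    refine measureReal_mono (Set.union_subset (Set.union_subset (key _ hy) (key _ hy')) h3) ?_
    rw [hD, h.measure (isBddOpen_ball _ _) (isBddOpen_ball _ _)]
    exact ENNReal.add_ne_top.2 ⟨(isBddOpen_ball _ _).ne_top, (isBddOpen_ball _ _).ne_top⟩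
  have hpos := measureReal_ball_pos (0 : Space d) one_pos
  rw [measureReal_union hd2 measurableSet_ball ((isBddOpen_ball _ _).union (isBddOpen_ball _ _)).ne_top,
    measureReal_union hd1 measurableSet_ball, hD,
    h.measureReal (isBddOpen_ball _ _) (isBddOpen_ball _ _), measureReal_ball _ hM0, measureReal_ball _ hM0,
    measureReal_ball _ (by positivity : 0 < r + M)] at hle
  have h5 : 2 * M ^ d ≤ (r + M) ^ d := by nlinarith
  have h6 : r + M = M * (1 + N⁻¹) := by rw [hM]; field_simp; ring
  rw [h6, mul_pow M] at h5
  have : 0 < M ^ d := by positivity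
  nlinarith

namespace IsSmash

variable (h : IsSmash op) {A A' B B' C : Set (Space d)}
include h

/-- Both summands fit into one ball. This makes associativity unconditional. -/
theorem isBounded (hA : IsBddOpen A) (hB : IsBddOpen B) : IsBounded (op A B) := by
  obtain ⟨K, hK, hK'⟩ := h.exists_op_ball_subset
  obtain ⟨r, hr, hAr⟩ := (hA.union hB).isBounded.subset_ball_lt 0 0
  refine isBounded_ball.subset ((h.mono hA (isBddOpen_ball 0 r) hB (isBddOpen_ball 0 r)
    (subset_union_left.trans hAr) (subset_union_right.trans hAr)).trans (hK' 0 r hr))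

theorem isBddOpen (hA : IsBddOpen A) (hB : IsBddOpen B) : IsBddOpen (op A B) :=
  ⟨h.isOpen hA hB, h.isBounded hA hB⟩

theorem assoc (hA : IsBddOpen A) (hB : IsBddOpen B) (hC : IsBddOpen C) :
    op (op A B) C = op A (op B C) :=
  h.six.assoc A B C hA.1 hA.2 hB.1 hB.2 hC.1 hC.2 (h.isBounded hA hB) (h.isBounded hB hC)

theorem right_comm (hA : IsBddOpen A) (hB : IsBddOpen B) (hC : IsBddOpen C) :
    op (op A B) C = op (op A C) B := by
  rw [h.assoc hA hB hC, h.comm hB hC, h.assoc hA hC hB]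

/-- Enlarging `A'` to `A ∪ A'` changes neither its measure nor, by conservation, that of the sum, so
the two nested sums agree almost everywhere. Null sets are thus invisible to the operation. -/
theorem ae_le_left (hA : IsBddOpen A) (hA' : IsBddOpen A') (hB : IsBddOpen B)
    (hs : A ≤ᵐ[volume] A') : op A B ≤ᵐ[volume] op A' B := by
  have h1 : op A B ⊆ op (A ∪ A') B := h.mono_left hA (hA.union hA') hB subset_union_left
  have h2 : op A' B ⊆ op (A ∪ A') B := h.mono_left hA' (hA.union hA') hB subset_union_right
  have h3 : volume (A ∪ A') ≤ volume A' := by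
    refine measure_mono_ae ?_
    filter_upwards [hs] with x hx
    rintro (hxA | hxA)
    · exact hx hxA
    · exact hxA
  have h4 := (h.isBddOpen hA' hB).ae_eq_of_subset (h.isBddOpen (hA.union hA') hB) h2 (by
    rw [h.measure (hA.union hA') hB, h.measure hA' hB]; gcongr)
  exact h1.eventuallyLE.trans h4.symm.le

theorem ae_eq_left (hA : IsBddOpen A) (hA' : IsBddOpen A') (hB : IsBddOpen B)
    (hs : A =ᵐ[volume] A') : op A B =ᵐ[volume] op A' B :=
  (h.ae_le_left hA hA' hB hs.le).antisymm (h.ae_le_left hA' hA hB hs.symm.le)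

theorem ae_eq_right (hA : IsBddOpen A) (hB : IsBddOpen B) (hB' : IsBddOpen B')
    (hs : B =ᵐ[volume] B') : op A B =ᵐ[volume] op A B' := by
  rw [h.comm hA hB, h.comm hA hB']
  exact h.ae_eq_left hB hB' hA hs

theorem union_ae_eq (hA : IsBddOpen A) (hB : IsBddOpen B) (hd : Disjoint A B) :
    (A ∪ B : Set (Space d)) =ᵐ[volume] op A B := by
  refine (hA.union hB).ae_eq_of_subset (h.isBddOpen hA hB) (h.union_subset hA hB) ?_
  rw [h.measure hA hB, measure_union hd hB.measurableSet]

theorem op_union_ae_eq (hA : IsBddOpen A) (hB : IsBddOpen B) (hC : IsBddOpen C)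
    (hd : Disjoint B C) : op A (B ∪ C) =ᵐ[volume] op (op A B) C := by
  rw [h.assoc hA hB hC]
  exact h.ae_eq_right hA (hB.union hC) (h.isBddOpen hB hC) (h.union_ae_eq hB hC hd)

theorem op_empty_ae_eq (hA : IsBddOpen A) : op A ∅ =ᵐ[volume] A := by
  simpa using (h.union_ae_eq hA isBddOpen_empty (disjoint_empty A)).symm

end IsSmash

end SmashSum

/-! ### The quadrature inequality with a defect, and its localisation to the overlap -/

namespace SmashSum

open Filter Set Metric Bornology

variable {d : ℕ} {op : Set (Space d) → Set (Space d) → Set (Space d)}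
  {g : Space d → ℝ} {b M : ℝ} {Ω : Set (Space d)}

/-- Sets that are invariant under all cubic isometries. -/
def IsCubicSymmetric (E : Set (Space d)) : Prop :=
  ∀ U : Space d ≃ₗᵢ[ℝ] Space d, IsCubicIsometry U → U '' E = E

/-- The averages of `g` over the cubically symmetric sets centred at `z` that are contained in the
annulus of radii `r` and `R` are smaller than `g z` by at least `γ`. -/
def HasSymmetricMeanGap (g : Space d → ℝ) (z : Space d) (r R γ : ℝ) : Prop :=
  ∀ E : Set (Space d), MeasurableSet E → IsCubicSymmetric E → E ⊆ ball 0 R \ ball 0 r →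
    ∫ v in E, g (v + z) ≤ volume.real E * (g z - γ)

/-- The quadrature inequality for `g` and for all sums inside `Ω`, with a defect that is at most
`M` times the measure of the second summand. -/
def QuadratureUpTo (op : Set (Space d) → Set (Space d) → Set (Space d)) (g : Space d → ℝ)
    (Ω : Set (Space d)) (M : ℝ) : Prop :=
  ∀ W X : Set (Space d), IsBddOpen W → IsBddOpen X → op W X ≤ᵐ[volume] Ω →
    ∫ x in op W X, g x ≤ (∫ x in W, g x) + (∫ x in X, g x) + M * volume.real X

theorem QuadratureUpTo.mono {M' : ℝ} (hq : QuadratureUpTo op g Ω M) (hM : M ≤ M') :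
    QuadratureUpTo op g Ω M' := fun W X hW hX hs =>
  (hq W X hW hX hs).trans (by gcongr)

theorem integrableOn_of_isBounded (hg : Continuous g) {S : Set (Space d)} (hS : IsBounded S) :
    IntegrableOn g S := by
  obtain ⟨r, hr⟩ := hS.subset_closedBall 0
  exact (hg.continuousOn.integrableOn_compact (isCompact_closedBall 0 r)).mono_set hr

theorem abs_setIntegral_le (hb : ∀ x, |g x| ≤ b) {S : Set (Space d)} (hS : IsBounded S) :
    |∫ x in S, g x| ≤ b * volume.real S :=
  Real.norm_eq_abs (∫ x in S, g x) ▸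
    norm_setIntegral_le_of_norm_le_const hS.measure_lt_top fun x _ => hb x

theorem setIntegral_eq_add_diff (hg : Continuous g) {S T : Set (Space d)} (hS : IsBounded S)
    (hT : MeasurableSet T) (hs : T ⊆ S) :
    ∫ x in S, g x = (∫ x in T, g x) + ∫ x in S \ T, g x := by
  have := integral_inter_add_sdiff (μ := volume) hT (integrableOn_of_isBounded hg hS)
  rw [← this, inter_eq_self_of_subset_right hs]

theorem measureReal_eq_add_diff {S T : Set (Space d)} (hS : IsBounded S)
    (hT : MeasurableSet T) (hs : T ⊆ S) :
    volume.real S = volume.real T + volume.real (S \ T) := by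
  have := measureReal_inter_add_sdiff (μ := volume) (s := S) hT hS.measure_lt_top.ne
  rw [← this, inter_eq_self_of_subset_right hs]

theorem nonneg_of_abs_le (hb : ∀ x : Space d, |g x| ≤ b) : 0 ≤ b := (abs_nonneg _).trans (hb 0)

namespace IsSmash

variable (h : IsSmash op) {A A' B B' C X Y W T : Set (Space d)}
include h

/-- By conservation of measure, the mass outside `X ∪ Y` has exactly the measure of `X ∩ Y`. Moving
that much mass changes the integral by at most `2 * b` per unit. -/
theorem setIntegral_op_le (hg : Continuous g) (hb : ∀ x, |g x| ≤ b)
    (hX : IsBddOpen X) (hY : IsBddOpen Y) :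
    ∫ x in op X Y, g x ≤
      (∫ x in X, g x) + (∫ x in Y, g x) + 2 * b * volume.real (X ∩ Y) := by
  have hS := h.isBddOpen hX hY
  have hU := hX.union hY
  have e1 := setIntegral_eq_add_diff hg hS.isBounded hU.measurableSet (h.union_subset hX hY)
  have e2 := setIntegral_eq_add_diff hg hU.isBounded hX.measurableSet subset_union_left
  have e3 := integral_inter_add_sdiff (μ := volume) hX.measurableSet
    (integrableOn_of_isBounded hg hY.isBounded)
  have m1 := measureReal_eq_add_diff hS.isBounded hU.measurableSet (h.union_subset hX hY)
  have m2 := measureReal_union_add_inter (μ := volume) (s := X) hY.measurableSet hX.ne_top hY.ne_top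
  have m3 := h.measureReal hX hY
  have b1 := abs_le.1 (abs_setIntegral_le hb (hS.isBounded.subset (sdiff_subset (t := X ∪ Y))))
  have b2 := abs_le.1 (abs_setIntegral_le hb (hX.isBounded.subset (inter_subset_left (t := Y))))
  rw [union_sdiff_left] at e2
  rw [inter_comm] at e3
  have m4 : volume.real (op X Y \ (X ∪ Y)) = volume.real (X ∩ Y) := by linarith
  rw [m4] at b1
  linarith [b1.2, b2.1]

theorem quadratureUpTo_two_mul (hg : Continuous g) (hb : ∀ x, |g x| ≤ b) :
    QuadratureUpTo op g Ω (2 * b) := fun W X hW hX _ => by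
  refine (h.setIntegral_op_le hg hb hW hX).trans ?_
  have hb0 := nonneg_of_abs_le hb
  have : volume.real (W ∩ X) ≤ volume.real X := measureReal_mono inter_subset_right hX.ne_top
  gcongr

theorem setIntegral_op_le_of_subset (hg : Continuous g) (hb : ∀ x, |g x| ≤ b)
    (hX : IsBddOpen X) (hY : IsBddOpen Y) (hT : IsBddOpen T) (hs : T ⊆ Y) :
    ∫ x in op X Y, g x ≤ (∫ x in op X T, g x) + b * volume.real (Y \ T) := by
  have hS := h.isBddOpen hX hY
  have hS' := h.isBddOpen hX hT
  have e1 := setIntegral_eq_add_diff hg hS.isBounded hS'.measurableSet (h.mono_right hX hT hY hs)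
  have m1 := measureReal_eq_add_diff hS.isBounded hS'.measurableSet (h.mono_right hX hT hY hs)
  have m2 := measureReal_eq_add_diff hY.isBounded hT.measurableSet hs
  rw [h.measureReal hX hY, h.measureReal hX hT] at m1
  have b1 := abs_le.1 (abs_setIntegral_le hb (hS.isBounded.subset (sdiff_subset (t := op X T))))
  have m4 : volume.real (op X Y \ op X T) = volume.real (Y \ T) := by linarith
  rw [m4] at b1
  linarith [b1.2]

/-- Up to small measure, `Y` is a disjoint union of open sets `Y₂`, almost disjoint from `X`, and
`Y₁ ⊆ X ∩ Y`. Adding `Y₂` first is nearly free, so the defect is paid only for `Y₁`. -/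
theorem setIntegral_op_le_overlap (hg : Continuous g) (hb : ∀ x, |g x| ≤ b) (hM : 0 ≤ M)
    (hq : QuadratureUpTo op g Ω M) (hX : IsBddOpen X) (hY : IsBddOpen Y)
    (hΩ : op X Y ≤ᵐ[volume] Ω) :
    ∫ x in op X Y, g x ≤
      (∫ x in X, g x) + (∫ x in Y, g x) + M * volume.real (X ∩ Y) := by
  have hb0 := nonneg_of_abs_le hb
  -- The error `6 * b * η` is the sum of three losses of `2 * b * η`: dropping the remainder of `Y`
  -- from the sum, dropping it from the integral over `Y`, and the overlap of `X` with `Y₂`.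
  suffices H : ∀ η : ℝ, 0 < η → ∫ x in op X Y, g x ≤
      (∫ x in X, g x) + (∫ x in Y, g x) + M * volume.real (X ∩ Y) + 6 * b * η by
    refine le_of_forall_pos_le_add fun ε hε => ?_
    refine (H (ε / (6 * b + 1)) (by positivity)).trans ?_
    have : 6 * b * (ε / (6 * b + 1)) ≤ ε := by
      rw [mul_div_assoc', div_le_iff₀ (by positivity)]; nlinarith
    linarith
  intro η hη
  have hXY := hX.inter_left hY.isOpen
  have hη' : ENNReal.ofReal η ≠ 0 := by simpa using hη
  -- `Y \ X` need not be open, so both pieces of `Y` are approximated by disjoint compact sets,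
  -- which have disjoint open neighbourhoods.
  obtain ⟨K₁, hK₁, hK₁c, hK₁m⟩ := hXY.measurableSet.exists_isCompact_sdiff_lt hXY.ne_top hη'
  have hYXm : MeasurableSet (Y \ X) := hY.measurableSet.diff hX.measurableSet
  have hYXf : volume (Y \ X) ≠ ⊤ := (hY.isBounded.subset sdiff_subset).measure_lt_top.ne
  obtain ⟨K₂, hK₂, hK₂c, hK₂m⟩ := hYXm.exists_isCompact_sdiff_lt hYXf hη'
  have hdisj : Disjoint K₁ K₂ := by
    refine disjoint_left.2 fun x h1 h2 => (hK₂ h2).2 (hK₁ h1).1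
  obtain ⟨U₁, U₂, hU₁, hU₂, hKU₁, hKU₂, hUd⟩ := SeparatedNhds.of_isCompact_isCompact hK₁c hK₂c hdisj
  have hY₁ : IsBddOpen (X ∩ Y ∩ U₁) := hXY.inter_left hU₁
  have hY₂ : IsBddOpen (Y ∩ U₂) := hY.inter_left hU₂
  set Y₁ := X ∩ Y ∩ U₁ with hY₁d
  set Y₂ := Y ∩ U₂ with hY₂d
  have hd : Disjoint Y₂ Y₁ :=
    (hUd.mono inter_subset_right inter_subset_right).symm
  have hT : IsBddOpen (Y₂ ∪ Y₁) := hY₂.union hY₁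
  have hTY : Y₂ ∪ Y₁ ⊆ Y := by
    rintro x (hx | hx)
    · exact hx.1
    · exact hx.1.2
  have lt₁ : volume.real ((X ∩ Y) \ K₁) ≤ η := ENNReal.toReal_le_of_le_ofReal hη.le hK₁m.le
  have lt₂ : volume.real ((Y \ X) \ K₂) ≤ η := ENNReal.toReal_le_of_le_ofReal hη.le hK₂m.le
  have f₁ : volume ((X ∩ Y) \ K₁) ≠ ⊤ := hK₁m.ne_top
  have f₂ : volume ((Y \ X) \ K₂) ≠ ⊤ := hK₂m.ne_top
  have hTm : volume.real (Y \ (Y₂ ∪ Y₁)) ≤ 2 * η := by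
    have hsub : Y \ (Y₂ ∪ Y₁) ⊆ ((X ∩ Y) \ K₁) ∪ ((Y \ X) \ K₂) := by
      rintro x ⟨hxY, hx⟩
      by_cases hxX : x ∈ X
      · exact Or.inl ⟨⟨hxX, hxY⟩, fun hxK => hx (Or.inr ⟨⟨hxX, hxY⟩, hKU₁ hxK⟩)⟩
      · exact Or.inr ⟨⟨hxY, hxX⟩, fun hxK => hx (Or.inl ⟨hxY, hKU₂ hxK⟩)⟩
    calc _ ≤ _ := measureReal_mono hsub (measure_union_ne_top f₁ f₂)
      _ ≤ _ := measureReal_union_le _ _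
      _ ≤ 2 * η := by linarith
  have hXY₂ : volume.real (X ∩ Y₂) ≤ η := by
    refine (measureReal_mono ?_ f₁).trans lt₁
    rintro x ⟨hxX, hxY, hxU⟩
    exact ⟨⟨hxX, hxY⟩, fun hxK => disjoint_left.1 hUd (hKU₁ hxK) hxU⟩
  have hY₁m : volume.real Y₁ ≤ volume.real (X ∩ Y) := measureReal_mono inter_subset_left hXY.ne_top
  have s1 := h.setIntegral_op_le_of_subset hg hb hX hY hT hTY
  have ae := h.op_union_ae_eq hX hY₂ hY₁ hd
  rw [setIntegral_congr_set ae] at s1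
  have s2 := hq (op X Y₂) Y₁ (h.isBddOpen hX hY₂) hY₁
    (ae.symm.le.trans ((h.mono_right hX hT hY hTY).eventuallyLE.trans hΩ))
  have s3 := h.setIntegral_op_le hg hb hX hY₂
  have s4 : ∫ x in Y₂ ∪ Y₁, g x = (∫ x in Y₂, g x) + ∫ x in Y₁, g x :=
    setIntegral_union hd hY₁.measurableSet (integrableOn_of_isBounded hg hY₂.isBounded)
      (integrableOn_of_isBounded hg hY₁.isBounded)
  have s5 := setIntegral_eq_add_diff hg hY.isBounded hT.measurableSet hTY
  have b1 := abs_le.1 (abs_setIntegral_le hb (hY.isBounded.subset (sdiff_subset (t := Y₂ ∪ Y₁))))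
  have p1 : b * volume.real (Y \ (Y₂ ∪ Y₁)) ≤ b * (2 * η) := by gcongr
  have p2 : 2 * b * volume.real (X ∩ Y₂) ≤ 2 * b * η := by gcongr
  have p3 : M * volume.real Y₁ ≤ M * volume.real (X ∩ Y) := by gcongr
  linarith [b1.1]

end IsSmash

end SmashSum

/-! ### Adding small balls improves the defect -/

namespace SmashSum

open Filter Set Metric Bornology

variable {d : ℕ} {op : Set (Space d) → Set (Space d) → Set (Space d)}
  {g : Space d → ℝ} {b M : ℝ} {Ω : Set (Space d)}

/-- Otherwise `V \ closure Ω` would be a nonempty open null set. -/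
theorem mem_closure_of_ae_le {V : Set (Space d)} (hV : IsOpen V) (hs : V ≤ᵐ[volume] Ω)
    {z : Space d} (hz : z ∈ V) : z ∈ closure Ω := by
  by_contra hzc
  have hO : IsOpen (V \ closure Ω) := hV.sdiff isClosed_closure
  have h0 : volume (V \ closure Ω) = 0 :=
    measure_mono_null (sdiff_subset_sdiff_right subset_closure) (ae_le_set.1 hs)
  exact (hO.measure_pos volume ⟨z, hz, hzc⟩).ne' h0

namespace IsSmash

variable (h : IsSmash op) {C X Y W T : Set (Space d)}
include h

/-- The sum of a ball and a smaller concentric ball, minus the larger ball, is cubically symmetric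
about the centre, so that the gap of the symmetric means applies to it. -/
theorem setIntegral_op_ball_diff_le {K r ρ γ : ℝ} {z : Space d}
    (hK : ∀ (z : Space d) (r : ℝ), 0 < r → op (ball z r) (ball z r) ⊆ ball z (K * r))
    (hr : 0 < r) (hρr : ρ ≤ r) (hgap : HasSymmetricMeanGap g z r (K * r) γ) :
    ∫ x in op (ball z r) (ball z ρ) \ ball z r, g x ≤ volume.real (ball z ρ) * (g z - γ) := by
  have hr' := isBddOpen_ball (0 : Space d) r
  have hρ' := isBddOpen_ball (0 : Space d) ρ
  set E := op (ball (0 : Space d) r) (ball 0 ρ) \ ball 0 r with hE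
  have himg : op (ball z r) (ball z ρ) \ ball z r = (fun c => c + z) '' E := by
    rw [hE, image_sdiff (add_left_injective z), ← h.op_ball_zero]
    simp [image_add_right, preimage_add_right_ball, sub_neg_eq_add]
  have hvol : volume.real E = volume.real (ball z ρ) := by
    have h1 := measureReal_eq_add_diff (h.isBddOpen hr' hρ').isBounded hr'.measurableSet
      (h.subset_left hr' hρ')
    rw [h.measureReal hr' hρ'] at h1
    have h2 : volume.real (ball z ρ) = volume.real (ball (0 : Space d) ρ) := by
      simp only [Measure.real, Measure.addHaar_ball_center]
    linarith
  rw [himg, (measurePreserving_add_right volume z).setIntegral_image_emb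
    (measurableEmbedding_addRight z) g E, ← hvol]
  refine hgap E ((h.isOpen hr' hρ').measurableSet.diff hr'.measurableSet) (fun U hU => ?_) ?_
  · rw [hE, image_sdiff U.injective, h.image_op_ball U hU]
    simp
  · exact sdiff_subset_sdiff_left ((h.mono_right hr' hρ' hr' (ball_subset_ball hρr)).trans (hK 0 r hr))

/-- The mass `L` gained by the inner part `V` of `W` has the same measure as the symmetric set `E`,
and its overlap with the outer part `Y` lies in `E`. On that overlap the old defect `M` is paid. The
remainders of `L` and `E` lie in the ball of radius `K * r`, so exchanging one for the other costs
at most `Λ * (2 * (K * r)) ≤ M` per unit. Hence `∫_L g + M |L ∩ Y| ≤ ∫_E g + M |C|`. The gap of `E`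
gains `γ`, of which half is spent on replacing `g z` by the average of `g` over `C`. -/
theorem setIntegral_op_ball_le {Λ K r ρ γ : ℝ} {z : Space d} (hg : Continuous g)
    (hb : ∀ x, |g x| ≤ b) (hΛ : ∀ x y, |g x - g y| ≤ Λ * dist x y) (hΛ0 : 0 ≤ Λ) (hM : 0 ≤ M)
    (hK : ∀ (z : Space d) (r : ℝ), 0 < r → op (ball z r) (ball z r) ⊆ ball z (K * r))
    (hr : 0 < r) (hρr : ρ ≤ r) (hMr : Λ * (2 * (K * r)) ≤ M) (hργ : Λ * ρ ≤ γ / 2)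
    (hgap : HasSymmetricMeanGap g z r (K * r) γ)
    (hq : QuadratureUpTo op g Ω M) (hW : IsBddOpen W) (hΩ : op W (ball z ρ) ≤ᵐ[volume] Ω) :
    ∫ x in op W (ball z ρ), g x ≤ (∫ x in W, g x) + (∫ x in ball z ρ, g x) +
      (M - γ / 2) * volume.real (ball z ρ) := by
  have hB := isBddOpen_ball z r
  have hC := isBddOpen_ball z ρ
  set C := ball z ρ with hCd
  set V := W ∩ ball z r with hVd
  set Y := W \ closedBall z r with hYd
  have hV : IsBddOpen V := hW.inter_left isOpen_ball
  have hY : IsBddOpen Y := hW.diff isClosed_closedBall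
  have hVC := h.isBddOpen hV hC
  have hBC := h.isBddOpen hB hC
  have hVY : Disjoint V Y := by
    refine disjoint_left.2 fun x hx hx' => hx'.2 (ball_subset_closedBall hx.2)
  -- Only points of the sphere of radius `r`, a null set, are lost.
  have hWae : (V ∪ Y : Set (Space d)) =ᵐ[volume] W := by
    refine (LE.le.eventuallyLE (Set.union_subset inter_subset_left sdiff_subset)).antisymm ?_
    rw [ae_le_set]
    refine measure_mono_null (fun x hx => ?_) (Measure.addHaar_sphere_of_ne_zero volume z hr.ne')
    by_contra hxs
    rcases lt_or_gt_of_ne hxs with h1 | h1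
    · exact hx.2 (Or.inl ⟨hx.1, h1⟩)
    · exact hx.2 (Or.inr ⟨hx.1, by simpa using h1⟩)
  -- the sum in two steps
  have hae : op W C =ᵐ[volume] op (op V C) Y := by
    have h1 := h.ae_eq_left (hV.union hY) hW hC hWae
    have h2 := h.ae_eq_left (hV.union hY) (h.isBddOpen hV hY) hC (h.union_ae_eq hV hY hVY)
    rw [h.right_comm hV hY hC] at h2
    exact h1.symm.trans h2
  rw [setIntegral_congr_set hae]
  have s1 := h.setIntegral_op_le_overlap hg hb hM hq hVC hY (hae.symm.le.trans hΩ)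
  set L := op V C \ V with hLd
  set E := op (ball z r) C \ ball z r with hEd
  have hLb : IsBounded L := hVC.isBounded.subset sdiff_subset
  have hEb : IsBounded E := hBC.isBounded.subset sdiff_subset
  have hLm : MeasurableSet L := hVC.measurableSet.diff hV.measurableSet
  have hEm : MeasurableSet E := hBC.measurableSet.diff hB.measurableSet
  have hsub : op V C ⊆ op (ball z r) C := h.mono_left hV hB hC inter_subset_right
  have hballK : op (ball z r) C ⊆ ball z (K * r) :=
    (h.mono_right hB hC hB (ball_subset_ball hρr)).trans (hK z r hr)
  have e1 := setIntegral_eq_add_diff hg hVC.isBounded hV.measurableSet (h.subset_left hV hC)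
  have e2 : ∫ x in W, g x = (∫ x in V, g x) + ∫ x in Y, g x := by
    rw [← setIntegral_congr_set hWae]
    exact setIntegral_union hVY hY.measurableSet (integrableOn_of_isBounded hg hV.isBounded)
      (integrableOn_of_isBounded hg hY.isBounded)
  have hLY : op V C ∩ Y = L ∩ Y := by
    ext x
    constructor
    · rintro ⟨hx, hxY⟩
      exact ⟨⟨hx, fun hxV => disjoint_left.1 hVY hxV hxY⟩, hxY⟩
    · rintro ⟨hx, hxY⟩
      exact ⟨hx.1, hxY⟩
  have hLE : L ∩ Y ⊆ E := by
    rintro x ⟨hx, hxY⟩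
    exact ⟨hsub hx.1, fun hxB => hxY.2 (ball_subset_closedBall hxB)⟩
  have hLYm : MeasurableSet (L ∩ Y) := hLm.inter hY.measurableSet
  have mL : volume.real L = volume.real C := by
    have := measureReal_eq_add_diff hVC.isBounded hV.measurableSet (h.subset_left hV hC)
    rw [h.measureReal hV hC] at this
    linarith
  have mE : volume.real E = volume.real C := by
    have := measureReal_eq_add_diff hBC.isBounded hB.measurableSet (h.subset_left hB hC)
    rw [h.measureReal hB hC] at this
    linarith
  have m1 := measureReal_eq_add_diff hLb hLYm inter_subset_left
  have m2 := measureReal_eq_add_diff hEb hLYm hLE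
  have i1 := setIntegral_eq_add_diff hg hLb hLYm inter_subset_left
  have i2 := setIntegral_eq_add_diff hg hEb hLYm hLE
  -- outside `L ∩ Y` the two sets are compared by the Lipschitz bound
  have hup : ∫ x in L \ (L ∩ Y), g x ≤ (g z + Λ * (K * r)) * volume.real (L \ (L ∩ Y)) := by
    have hb' : IsBounded (L \ (L ∩ Y)) := hLb.subset sdiff_subset
    have hc : IntegrableOn (fun _ : Space d => g z + Λ * (K * r)) (L \ (L ∩ Y)) :=
      integrableOn_const hb'.measure_lt_top.ne
    have := setIntegral_mono_on (integrableOn_of_isBounded hg hb') hc (hLm.diff hLYm)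
      (fun x hx => by
        have h1 := (abs_le.1 (hΛ x z)).2
        have h2 : dist x z ≤ K * r := (mem_ball.1 (hballK (hsub hx.1.1))).le
        have h3 : Λ * dist x z ≤ Λ * (K * r) := by gcongr
        linarith)
    rw [setIntegral_const, smul_eq_mul] at this
    linarith
  have hlow : (g z - Λ * (K * r)) * volume.real (E \ (L ∩ Y)) ≤ ∫ x in E \ (L ∩ Y), g x := by
    have hb' : IsBounded (E \ (L ∩ Y)) := hEb.subset sdiff_subset
    have hc : IntegrableOn (fun _ : Space d => g z - Λ * (K * r)) (E \ (L ∩ Y)) :=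
      integrableOn_const hb'.measure_lt_top.ne
    have := setIntegral_mono_on hc (integrableOn_of_isBounded hg hb') (hEm.diff hLYm)
      (fun x hx => by
        have h1 := (abs_le.1 (hΛ x z)).1
        have h2 : dist x z ≤ K * r := (mem_ball.1 (hballK hx.1.1)).le
        have h3 : Λ * dist x z ≤ Λ * (K * r) := by gcongr
        linarith)
    rw [setIntegral_const, smul_eq_mul] at this
    linarith
  have hClow : (g z - γ / 2) * volume.real C ≤ ∫ x in C, g x := by
    have hc : IntegrableOn (fun _ : Space d => g z - γ / 2) C := integrableOn_const hC.ne_top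
    have := setIntegral_mono_on hc (integrableOn_of_isBounded hg hC.isBounded) hC.measurableSet
      (fun x hx => by
        have h1 := (abs_le.1 (hΛ x z)).1
        have h2 : dist x z ≤ ρ := (mem_ball.1 hx).le
        have h3 : Λ * dist x z ≤ Λ * ρ := by gcongr
        linarith)
    rw [setIntegral_const, smul_eq_mul] at this
    linarith
  have hgapE := h.setIntegral_op_ball_diff_le hK hr hρr hgap
  rw [← hCd, ← hEd] at hgapE
  have hmeq : volume.real (E \ (L ∩ Y)) = volume.real (L \ (L ∩ Y)) := by linarith
  have hMr' : Λ * (2 * (K * r)) * volume.real (L \ (L ∩ Y)) ≤ M * volume.real (L \ (L ∩ Y)) := by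
    gcongr
  rw [hLY] at s1
  rw [hmeq] at hlow
  have hML : M * volume.real C = M * volume.real (L ∩ Y) + M * volume.real (L \ (L ∩ Y)) := by
    rw [← mL, m1]; ring
  nlinarith

/-- The balls are added one at a time. The one-ball estimate must hold for every `W`, since it is
applied to the sum already formed. -/
theorem setIntegral_op_biUnion_ball_le {ι : Type*} {c : ι → Space d} {ρ : ι → ℝ} {M' : ℝ}
    (hg : Continuous g)
    (t : Finset ι) (hd : (t : Set ι).PairwiseDisjoint fun i => ball (c i) (ρ i))
    (hstep : ∀ i ∈ t, ∀ W : Set (Space d), IsBddOpen W → op W (ball (c i) (ρ i)) ≤ᵐ[volume] Ω →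
      ∫ x in op W (ball (c i) (ρ i)), g x ≤ (∫ x in W, g x) + (∫ x in ball (c i) (ρ i), g x) +
        M' * volume.real (ball (c i) (ρ i)))
    (hW : IsBddOpen W) (hΩ : op W (⋃ i ∈ t, ball (c i) (ρ i)) ≤ᵐ[volume] Ω) :
    ∫ x in op W (⋃ i ∈ t, ball (c i) (ρ i)), g x ≤ (∫ x in W, g x) +
      (∫ x in ⋃ i ∈ t, ball (c i) (ρ i), g x) +
      M' * volume.real (⋃ i ∈ t, ball (c i) (ρ i)) := by
  classical
  induction t using Finset.induction_on with
  | empty =>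
    simp only [Finset.notMem_empty, iUnion_of_empty, iUnion_empty]
    rw [setIntegral_congr_set (h.op_empty_ae_eq hW)]
    simp
  | insert i t hi ih =>
    have hT : IsBddOpen (⋃ j ∈ t, ball (c j) (ρ j)) :=
      ⟨isOpen_biUnion fun _ _ => isOpen_ball, (isBounded_biUnion t.finite_toSet).2
        fun _ _ => isBounded_ball⟩
    have hC := isBddOpen_ball (c i) (ρ i)
    have hdis : Disjoint (⋃ j ∈ t, ball (c j) (ρ j)) (ball (c i) (ρ i)) := by
      refine disjoint_iUnion₂_left.2 fun j hj => ?_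
      exact hd (by simp [hj]) (by simp) (fun hji => hi (hji ▸ hj))
    have hins : (⋃ j ∈ insert i t, ball (c j) (ρ j)) =
        (⋃ j ∈ t, ball (c j) (ρ j)) ∪ ball (c i) (ρ i) := by
      rw [Finset.set_biUnion_insert, union_comm]
    rw [hins] at hΩ ⊢
    set T := ⋃ j ∈ t, ball (c j) (ρ j)
    have ae := h.op_union_ae_eq hW hT hC hdis
    have hWT := h.isBddOpen hW hT
    have s1 := hstep i (by simp) (op W T) hWT (ae.symm.le.trans hΩ)
    have s2 := ih (hd.subset (by simp)) (fun j hj => hstep j (by simp [hj]))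
      ((h.subset_left hWT hC).eventuallyLE.trans (ae.symm.le.trans hΩ))
    rw [setIntegral_congr_set ae, setIntegral_union hdis hC.measurableSet
      (integrableOn_of_isBounded hg hT.isBounded) (integrableOn_of_isBounded hg hC.isBounded),
      measureReal_union hdis hC.measurableSet hT.ne_top hC.ne_top]
    linarith

end IsSmash

end SmashSum

/-! ### Filling by balls and iterating the improvement -/

namespace SmashSum

open Filter Set Metric Bornology

variable {d : ℕ} {op : Set (Space d) → Set (Space d) → Set (Space d)}
  {g : Space d → ℝ} {b M : ℝ} {Ω : Set (Space d)}

/-- A bounded open set is filled, up to measure `η`, by finitely many disjoint small balls. -/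
theorem IsBddOpen.exists_finset_ball {X : Set (Space d)} (hX : IsBddOpen X) {R η : ℝ}
    (hR : 0 < R) (hη : 0 < η) :
    ∃ (t : Finset (Space d)) (ρ : Space d → ℝ), (∀ x ∈ t, x ∈ X ∧ 0 < ρ x ∧ ρ x < R) ∧
      ((t : Set (Space d)).PairwiseDisjoint fun x => ball x (ρ x)) ∧
      (⋃ x ∈ t, ball x (ρ x)) ⊆ X ∧ volume.real (X \ ⋃ x ∈ t, ball x (ρ x)) ≤ η := by
  obtain ⟨t, ρ, htc, htX, hρ, hcov, hdisj⟩ := Besicovitch.exists_disjoint_closedBall_covering_ae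
    volume (fun x => {r | closedBall x r ⊆ X}) X (fun x hx δ hδ => by
      obtain ⟨ε, hε, hεX⟩ := nhds_basis_closedBall.mem_iff.1 (hX.isOpen.mem_nhds hx)
      refine ⟨min ε (δ / 2), (closedBall_subset_closedBall (min_le_left _ _)).trans hεX,
        lt_min hε (by linarith), (min_le_right _ _).trans_lt (by linarith)⟩) (fun _ => R)
    (fun _ _ => hR)
  have hsub : ∀ x ∈ t, ball x (ρ x) ⊆ X := fun x hx =>
    ball_subset_closedBall.trans (hρ x hx).1
  have hcov' : volume (X \ ⋃ x ∈ t, ball x (ρ x)) = 0 := by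
    have hs : volume (⋃ x ∈ t, sphere x (ρ x)) = 0 :=
      (measure_biUnion_null_iff htc).2 fun x hx =>
        Measure.addHaar_sphere_of_ne_zero volume x (hρ x hx).2.1.ne'
    refine measure_mono_null (fun y hy => ?_) (measure_union_null hcov hs)
    by_cases hyc : y ∈ ⋃ x ∈ t, closedBall x (ρ x)
    · right
      simp only [mem_iUnion, exists_prop] at hyc hy ⊢
      obtain ⟨x, hx, hxy⟩ := hyc
      refine ⟨x, hx, le_antisymm hxy (not_lt.1 fun hlt => hy.2 ?_)⟩
      simp only [mem_iUnion, exists_prop]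
      exact ⟨x, hx, hlt⟩
    · exact Or.inl ⟨hy.1, hyc⟩
  have hUX : (⋃ x ∈ t, ball x (ρ x)) ⊆ X := iUnion₂_subset hsub
  have hdisj' : t.PairwiseDisjoint fun x => ball x (ρ x) := fun x hx y hy hxy =>
    (hdisj hx hy hxy).mono ball_subset_closedBall ball_subset_closedBall
  have hmX : volume (⋃ x ∈ t, ball x (ρ x)) = volume X := by
    refine le_antisymm (measure_mono hUX) ?_
    calc volume X ≤ volume ((X \ ⋃ x ∈ t, ball x (ρ x)) ∪ ⋃ x ∈ t, ball x (ρ x)) :=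
          measure_mono (by rw [sdiff_union_self]; exact subset_union_left)
      _ ≤ _ := measure_union_le _ _
      _ = _ := by rw [hcov', zero_add]
  have hsum := measure_biUnion (μ := volume) htc hdisj' fun x _ => measurableSet_ball
  have hsummable : HasSum (fun x : t => volume (ball (x : Space d) (ρ x))) (volume X) := by
    rw [← hmX, hsum]; exact ENNReal.summable.hasSum
  have hlt : volume X - ENNReal.ofReal η < volume X ∨ volume X = 0 := by
    rcases eq_or_ne (volume X) 0 with h0 | h0
    · exact Or.inr h0
    · exact Or.inl (ENNReal.sub_lt_self hX.ne_top h0 (by simpa using hη))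
  rcases hlt with hlt | h0
  · obtain ⟨s, hs⟩ := (hsummable.eventually (lt_mem_nhds hlt)).exists
    classical
    refine ⟨s.image Subtype.val, ρ, ?_, ?_, ?_, ?_⟩
    · intro x hx
      obtain ⟨y, -, rfl⟩ := Finset.mem_image.1 hx
      exact ⟨htX y.2, (hρ y y.2).2⟩
    · refine hdisj'.subset fun x hx => ?_
      obtain ⟨y, -, rfl⟩ := Finset.mem_image.1 hx
      exact y.2
    · refine iUnion₂_subset fun x hx => ?_
      obtain ⟨y, -, rfl⟩ := Finset.mem_image.1 hx
      exact hsub y y.2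
    · have hs' : (⋃ x ∈ s.image Subtype.val, ball x (ρ x)) ⊆ X := by
        refine iUnion₂_subset fun x hx => ?_
        obtain ⟨y, -, rfl⟩ := Finset.mem_image.1 hx
        exact hsub y y.2
      have hsm : volume (⋃ x ∈ s.image Subtype.val, ball x (ρ x)) =
          ∑ x ∈ s, volume (ball (x : Space d) (ρ x)) := by
        rw [measure_biUnion_finset, Finset.sum_image (by simp)]
        · refine hdisj'.subset fun x hx => ?_
          obtain ⟨y, -, rfl⟩ := Finset.mem_image.1 hx
          exact y.2
        · exact fun _ _ => measurableSet_ball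
      refine ENNReal.toReal_le_of_le_ofReal hη.le ?_
      have hmeas : MeasurableSet (⋃ x ∈ s.image Subtype.val, ball x (ρ x)) :=
        (isOpen_biUnion fun _ _ => isOpen_ball).measurableSet
      rw [measure_sdiff hs' hmeas.nullMeasurableSet
        (measure_ne_top_of_subset hs' hX.ne_top), hsm]
      rw [tsub_le_iff_left]
      rw [add_comm]
      exact tsub_le_iff_left.1 hs.le
  · refine ⟨∅, ρ, by simp, by simp, by simp, ?_⟩
    simp [Measure.real, h0, hη.le]

namespace IsSmash

variable (h : IsSmash op) {C X Y W T : Set (Space d)}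
include h

/-- The one-ball improvement carries over to `X` because small disjoint balls fill it up to
arbitrarily small measure. Their centres lie in `closure Ω`, where the gap is assumed. -/
theorem quadratureUpTo_sub {Λ K r γ : ℝ} (hg : Continuous g)
    (hb : ∀ x, |g x| ≤ b) (hΛ : ∀ x y, |g x - g y| ≤ Λ * dist x y) (hΛ0 : 0 ≤ Λ) (hM : 0 ≤ M)
    (hK : ∀ (z : Space d) (r : ℝ), 0 < r → op (ball z r) (ball z r) ⊆ ball z (K * r))
    (hr : 0 < r) (hMr : Λ * (2 * (K * r)) ≤ M) (hγ : 0 < γ)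
    (hgap : ∀ z ∈ closure Ω, HasSymmetricMeanGap g z r (K * r) γ)
    (hq : QuadratureUpTo op g Ω M) : QuadratureUpTo op g Ω (M - γ / 2) := by
  intro W X hW hX hΩ
  have hb0 := nonneg_of_abs_le hb
  set M' := M - γ / 2 with hM'
  -- Balls this small satisfy both `ρ ≤ r` and `Λ * ρ ≤ γ / 2`.
  set R := min r (γ / 2 / (Λ + 1)) with hR
  have hR0 : 0 < R := lt_min hr (by positivity)
  have hΛR : ∀ ρ < R, Λ * ρ ≤ γ / 2 := fun ρ hρ => by
    have h1 : ρ ≤ γ / 2 / (Λ + 1) := hρ.le.trans (min_le_right _ _)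
    calc Λ * ρ ≤ Λ * (γ / 2 / (Λ + 1)) := by gcongr
      _ ≤ γ / 2 := by
        rw [mul_div_assoc', div_le_iff₀ (by positivity)]; nlinarith
  suffices H : ∀ η : ℝ, 0 < η → ∫ x in op W X, g x ≤
      (∫ x in W, g x) + (∫ x in X, g x) + M' * volume.real X + (2 * b + |M'|) * η by
    refine le_of_forall_pos_le_add fun ε hε => ?_
    have hc : 0 ≤ 2 * b + |M'| := by positivity
    refine (H (ε / (2 * b + |M'| + 1)) (by positivity)).trans ?_
    have : (2 * b + |M'|) * (ε / (2 * b + |M'| + 1)) ≤ ε := by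
      rw [mul_div_assoc', div_le_iff₀ (by positivity)]; nlinarith
    linarith
  intro η hη
  obtain ⟨t, ρ, ht, hd, htX, htη⟩ := hX.exists_finset_ball hR0 hη
  set T := ⋃ x ∈ t, ball x (ρ x) with hTd
  have hT : IsBddOpen T := ⟨isOpen_biUnion fun _ _ => isOpen_ball, hX.isBounded.subset htX⟩
  have hΩT : op W T ≤ᵐ[volume] Ω := ((h.mono_right hW hT hX htX).eventuallyLE).trans hΩ
  have s1 := h.setIntegral_op_le_of_subset hg hb hW hX hT htX
  have s2 := h.setIntegral_op_biUnion_ball_le (c := id) (M' := M') hg t hd (fun z hz W' hW' hΩ' => by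
    have hz' : z ∈ closure Ω := mem_closure_of_ae_le (h.isOpen hW' (isBddOpen_ball _ _)) hΩ'
      (h.subset_right hW' (isBddOpen_ball _ _) (mem_ball_self (ht z hz).2.1))
    exact h.setIntegral_op_ball_le hg hb hΛ hΛ0 hM hK hr
      ((ht z hz).2.2.le.trans (min_le_left _ _)) hMr (hΛR _ (ht z hz).2.2) (hgap z hz') hq hW' hΩ')
    hW hΩT
  simp only [id] at s2
  rw [← hTd] at s2
  have s3 := setIntegral_eq_add_diff hg hX.isBounded hT.measurableSet htX
  have m3 := measureReal_eq_add_diff hX.isBounded hT.measurableSet htX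
  have b1 := abs_le.1 (abs_setIntegral_le hb (hX.isBounded.subset (sdiff_subset (t := T))))
  have p1 : b * volume.real (X \ T) ≤ b * η := by gcongr
  have p2 : -M' * volume.real (X \ T) ≤ |M'| * η := by
    have := neg_le_abs M'
    gcongr
  have p3 : M' * volume.real X = M' * volume.real T + M' * volume.real (X \ T) := by
    rw [m3]; ring
  linarith [b1.1]

/-- The quadrature inequality for a bounded Lipschitz function whose symmetric means have a gap at
arbitrarily small scales. -/
theorem quadratureUpTo_zero {Λ K : ℝ} (hb : ∀ x, |g x| ≤ b)
    (hΛ : ∀ x y, |g x - g y| ≤ Λ * dist x y) (hK1 : 1 ≤ K)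
    (hK : ∀ (z : Space d) (r : ℝ), 0 < r → op (ball z r) (ball z r) ⊆ ball z (K * r))
    (hgap : ∀ ε > 0, ∃ r > 0, r ≤ ε ∧ ∃ γ > 0, ∀ z ∈ closure Ω,
      HasSymmetricMeanGap g z r (K * r) γ) :
    QuadratureUpTo op g Ω 0 := by
  wlog hΛ0 : 0 ≤ Λ generalizing Λ
  · exact this (Λ := 0) (fun x y => (hΛ x y).trans (by
      have := dist_nonneg (x := x) (y := y)
      nlinarith [not_le.1 hΛ0])) le_rfl
  have hg : Continuous g :=
    (LipschitzWith.of_dist_le_mul (K := ⟨Λ, hΛ0⟩) fun x y => hΛ x y).continuous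
  have key : ∀ θ > 0, QuadratureUpTo op g Ω θ := by
    intro θ hθ
    obtain ⟨r, hr, hrε, γ, hγ, hgap'⟩ := hgap (θ / (2 * K * (Λ + 1))) (by positivity)
    have hMr : Λ * (2 * (K * r)) ≤ θ := by
      rw [le_div_iff₀ (by positivity)] at hrε
      nlinarith [mul_pos (by linarith : 0 < K) hr]
    -- The scale `r` and the gap `γ` are fixed once `θ` is. The improvement step is available while
    -- the defect is at least `θ`, and finitely many steps reach `θ`.
    have hn : ∀ n : ℕ, QuadratureUpTo op g Ω (max θ (2 * b - n * (γ / 2))) := by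
      intro n
      induction n with
      | zero => exact (h.quadratureUpTo_two_mul hg hb).mono (by simp)
      | succ n ih =>
        refine (h.quadratureUpTo_sub hg hb hΛ hΛ0 (hθ.le.trans (le_max_left _ _)) hK hr
          (hMr.trans (le_max_left _ _)) hγ hgap' ih).mono ?_
        rcases le_total θ (2 * b - n * (γ / 2)) with h1 | h1
        · rw [max_eq_right h1]
          refine le_trans ?_ (le_max_right _ _)
          push_cast; linarith
        · rw [max_eq_left h1]
          exact le_trans (by linarith) (le_max_left _ _)
    obtain ⟨n, hn'⟩ := exists_nat_gt (2 * b / (γ / 2))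
    refine (hn n).mono (max_le le_rfl ?_)
    rw [div_lt_iff₀ (by positivity)] at hn'
    linarith
  intro W X hW hX hs
  refine le_of_forall_pos_le_add fun ε hε => ?_
  have hv : 0 ≤ volume.real X := measureReal_nonneg
  refine (key (ε / (volume.real X + 1)) (by positivity) W X hW hX hs).trans ?_
  have : ε / (volume.real X + 1) * volume.real X ≤ ε := by
    rw [div_mul_eq_mul_div, div_le_iff₀ (by positivity)]; nlinarith
  linarith

end IsSmash

end SmashSum

/-! ### Cubic symmetry, Taylor expansion and the Laplacian -/

namespace SmashSum

open Filter Set Metric Bornology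

variable {d : ℕ}

theorem isCubicIsometry_of_forall {U : Space d ≃ₗᵢ[ℝ] Space d}
    (hU : ∀ x, x ∈ cube d ↔ U x ∈ cube d) : IsCubicIsometry U := by
  ext x
  constructor
  · rintro ⟨y, hy, rfl⟩
    exact (hU y).1 hy
  · intro hx
    exact ⟨U.symm x, (hU _).2 (by simpa using hx), by simp⟩

/-- The reflection that changes the sign of the `i`-th coordinate. -/
noncomputable def flip (i : Fin d) : Space d ≃ₗᵢ[ℝ] Space d :=
  LinearIsometryEquiv.piLpCongrRight 2
    fun j => if j = i then LinearIsometryEquiv.neg ℝ else LinearIsometryEquiv.refl ℝ ℝ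

theorem flip_apply (i j : Fin d) (x : Space d) : flip i x j = if j = i then -x j else x j := by
  simp only [flip, LinearIsometryEquiv.piLpCongrRight_apply]
  split_ifs <;> simp

theorem isCubicIsometry_flip (i : Fin d) : IsCubicIsometry (flip i) := by
  refine isCubicIsometry_of_forall fun x => forall_congr' fun j => ?_
  rw [flip_apply]
  split_ifs <;> simp

/-- The reflection that exchanges two coordinates. -/
noncomputable def exchange (i j : Fin d) : Space d ≃ₗᵢ[ℝ] Space d :=
  LinearIsometryEquiv.piLpCongrLeft 2 ℝ ℝ (Equiv.swap i j)

theorem exchange_apply (i j k : Fin d) (x : Space d) : exchange i j x k = x (Equiv.swap i j k) := by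
  simp [exchange, LinearIsometryEquiv.piLpCongrLeft_apply, Equiv.piCongrLeft'_apply]

theorem isCubicIsometry_exchange (i j : Fin d) : IsCubicIsometry (exchange i j) := by
  refine isCubicIsometry_of_forall fun x => ?_
  simp only [cube, mem_ofPred_eq, exchange_apply]
  exact (Equiv.forall_congr_right (Equiv.swap i j) (q := fun k => |x k| ≤ 1)).symm

theorem isCubicSymmetric_ball (r : ℝ) : IsCubicSymmetric (ball (0 : Space d) r) := fun U _ => by
  simp

theorem clm_eq_sum (L : Space d →L[ℝ] ℝ) (v : Space d) :
    L v = ∑ i, v i * L (EuclideanSpace.basisFun (Fin d) ℝ i) := by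
  have h := congrArg L ((EuclideanSpace.basisFun (Fin d) ℝ).sum_repr v)
  rw [map_sum] at h
  rw [← h]
  exact Finset.sum_congr rfl fun i _ => by rw [map_smul, EuclideanSpace.basisFun_repr, smul_eq_mul]

namespace IsCubicSymmetric

variable {E : Set (Space d)} (hE : IsCubicSymmetric E)
include hE

theorem setIntegral_comp {U : Space d ≃ₗᵢ[ℝ] Space d} (hU : IsCubicIsometry U) (f : Space d → ℝ) :
    ∫ v in E, f (U v) = ∫ v in E, f v := by
  have := (U.measurePreserving).setIntegral_image_emb U.toHomeomorph.measurableEmbedding f E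
  rw [← this, hE U hU]

theorem setIntegral_coord (i : Fin d) : ∫ v in E, v i = 0 := by
  have := hE.setIntegral_comp (isCubicIsometry_flip i) (fun v => v i)
  simp only [flip_apply, if_true, integral_neg] at this
  linarith

theorem setIntegral_coord_mul_of_ne {i j : Fin d} (hij : i ≠ j) : ∫ v in E, v i * v j = 0 := by
  have := hE.setIntegral_comp (isCubicIsometry_flip i) (fun v => v i * v j)
  simp only [flip_apply, if_true, if_neg hij.symm, neg_mul, integral_neg] at this
  linarith

theorem setIntegral_coord_mul_self (i j : Fin d) :
    ∫ v in E, v i * v i = ∫ v in E, v j * v j := by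
  have := hE.setIntegral_comp (isCubicIsometry_exchange i j) (fun v => v j * v j)
  simpa [exchange_apply] using this

theorem setIntegral_clm (hb : IsBounded E) (L : Space d →L[ℝ] ℝ) : ∫ v in E, L v = 0 := by
  rw [integral_congr_ae (Eventually.of_forall (clm_eq_sum L)), integral_finsetSum]
  · exact Finset.sum_eq_zero fun i _ => by rw [integral_mul_const, hE.setIntegral_coord, zero_mul]
  · exact fun i _ => integrableOn_of_isBounded (by fun_prop) hb

/-- The trace of a bilinear form. -/
noncomputable def _root_.SmashSum.trace (H : Space d →L[ℝ] Space d →L[ℝ] ℝ) : ℝ :=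
  ∑ i, H (EuclideanSpace.basisFun (Fin d) ℝ i) (EuclideanSpace.basisFun (Fin d) ℝ i)

/-- Sign changes of coordinates kill the mixed second moments and exchanges of coordinates equate
the pure ones. The cubic isometries thus suffice to see only the Laplacian. -/
theorem setIntegral_bilinear (hb : IsBounded E) (H : Space d →L[ℝ] Space d →L[ℝ] ℝ) :
    d * ∫ v in E, H v v = trace H * ∫ v in E, ‖v‖ ^ 2 := by
  set e := EuclideanSpace.basisFun (Fin d) ℝ with he
  have hH : ∀ v : Space d, H v v = ∑ i, ∑ j, (v i * v j) * H (e i) (e j) := fun v => by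
    have h1 : H v v = ∑ i, v i * H (e i) v := clm_eq_sum (H.flip v) v
    rw [h1]
    refine Finset.sum_congr rfl fun i _ => ?_
    rw [clm_eq_sum (H (e i)) v, Finset.mul_sum]
    exact Finset.sum_congr rfl fun j _ => (mul_assoc _ _ _).symm
  have hint : ∀ f : Space d → ℝ, Continuous f → IntegrableOn f E := fun f hf =>
    integrableOn_of_isBounded hf hb
  have hnorm : ∫ v in E, ‖v‖ ^ 2 = ∑ i : Fin d, ∫ v in E, v i * v i := by
    rw [← integral_finsetSum _ fun i _ => hint _ (by fun_prop)]
    refine integral_congr_ae (Eventually.of_forall fun v => ?_)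
    simp only [EuclideanSpace.norm_sq_eq, Real.norm_eq_abs, sq_abs]
    exact Finset.sum_congr rfl fun i _ => sq _
  have h1 : ∫ v in E, H v v = ∑ i, (∫ v in E, v i * v i) * H (e i) (e i) := by
    rw [integral_congr_ae (Eventually.of_forall hH), integral_finsetSum _ fun i _ => hint _ (by fun_prop)]
    refine Finset.sum_congr rfl fun i _ => ?_
    rw [integral_finsetSum _ fun i _ => hint _ (by fun_prop)]
    simp_rw [integral_mul_const]
    rw [Finset.sum_eq_single i (fun j _ hj => by
      rw [hE.setIntegral_coord_mul_of_ne hj.symm, zero_mul]) (by simp)]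
  rw [h1, hnorm, trace, Finset.mul_sum, Finset.sum_mul]
  refine Finset.sum_congr rfl fun i _ => ?_
  rw [Finset.sum_congr rfl fun j _ => hE.setIntegral_coord_mul_self j i]
  simp [he]
  ring

end IsCubicSymmetric

/-- The mean value inequality along the segment `t • v + z`. The remainder has derivative `(f' (t •
v + z) - f' z - H (t • v)) v`, so no symmetry of `H` is needed. -/
theorem abs_taylor_le {V : Type*} [NormedAddCommGroup V] [NormedSpace ℝ V] {f : V → ℝ}
    {f' : V → V →L[ℝ] ℝ} {H : V →L[ℝ] V →L[ℝ] ℝ} {C : ℝ} {z : V} (hC : 0 ≤ C)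
    (hf : ∀ x, HasFDerivAt f (f' x) x)
    (hH : ∀ w, ‖f' (w + z) - f' z - H w‖ ≤ C * ‖w‖ ^ 2) (v : V) :
    |f (v + z) - f z - f' z v - H v v / 2| ≤ C * ‖v‖ ^ 3 := by
  have hRd : ∀ t : ℝ, HasDerivAt (fun t : ℝ => f (t • v + z) - t * f' z v - t ^ 2 * (H v v / 2))
      (f' (t • v + z) v - 1 * f' z v - (2 * t ^ 1) * (H v v / 2)) t := by
    intro t
    have hl : HasDerivAt (fun t : ℝ => t • v + z) v t := by
      have := ((hasDerivAt_id t).smul_const v).add_const z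
      rwa [one_smul] at this
    have ha : HasDerivAt (fun t : ℝ => f (t • v + z)) (f' (t • v + z) v) t :=
      (hf (t • v + z)).comp_hasDerivAt t hl
    have hb : HasDerivAt (fun t : ℝ => t * f' z v) (1 * f' z v) t :=
      (hasDerivAt_id t).mul_const (f' z v)
    have hc : HasDerivAt (fun t : ℝ => t ^ 2 * (H v v / 2)) ((2 * t ^ 1) * (H v v / 2)) t := by
      have := (hasDerivAt_pow 2 t).mul_const (H v v / 2)
      exact_mod_cast this
    exact (ha.sub hb).sub hc
  have hbound : ∀ t ∈ Icc (0 : ℝ) 1, ‖f' (t • v + z) v - 1 * f' z v - (2 * t ^ 1) * (H v v / 2)‖ ≤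
      C * ‖v‖ ^ 3 := by
    intro t ht
    have e : f' (t • v + z) v - 1 * f' z v - (2 * t ^ 1) * (H v v / 2) =
        (f' (t • v + z) - f' z - H (t • v)) v := by
      simp only [sub_apply, map_smul, smul_apply,
        smul_eq_mul]
      ring
    rw [e]
    have ht2 : ‖t • v‖ ≤ ‖v‖ := by
      rw [norm_smul, Real.norm_of_nonneg ht.1]
      exact mul_le_of_le_one_left (norm_nonneg _) ht.2
    calc _ ≤ _ := ContinuousLinearMap.le_opNorm _ _
      _ ≤ (C * ‖t • v‖ ^ 2) * ‖v‖ := by gcongr; exact hH _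
      _ ≤ (C * ‖v‖ ^ 2) * ‖v‖ := by gcongr
      _ = C * ‖v‖ ^ 3 := by ring
  have := (convex_Icc (0 : ℝ) 1).norm_image_sub_le_of_norm_hasDerivWithin_le
    (fun t _ => (hRd t).hasDerivWithinAt) hbound (left_mem_Icc.2 zero_le_one)
    (right_mem_Icc.2 zero_le_one)
  simp only [one_smul, zero_smul, zero_add, sub_zero, norm_one, mul_one, one_mul, zero_mul,
    one_pow, Real.norm_eq_abs, ne_eq, OfNat.ofNat_ne_zero, not_false_eq_true, zero_pow] at this
  refine le_trans (le_of_eq ?_) this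
  congr 1
  ring

theorem exists_lipschitzWith_fderiv_fderiv {V : Type*} [NormedAddCommGroup V] [NormedSpace ℝ V] {G : V → ℝ}
    (hG : ContDiff ℝ 3 G) (hGc : HasCompactSupport G) :
    ∃ C : NNReal, LipschitzWith C (fderiv ℝ (fderiv ℝ G)) := by
  have h1 : ContDiff ℝ 2 (fderiv ℝ G) := hG.fderiv_right (by norm_num)
  have h2 : ContDiff ℝ 1 (fderiv ℝ (fderiv ℝ G)) := h1.fderiv_right (by norm_num)
  exact h2.lipschitzWith_of_hasCompactSupport ((hGc.fderiv ℝ).fderiv ℝ) one_ne_zero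

theorem norm_fderiv_sub_le_of_lipschitzWith {V : Type*} [NormedAddCommGroup V] [NormedSpace ℝ V] {G : V → ℝ}
    (z w : V) (C : NNReal) (hD1 : Differentiable ℝ (fderiv ℝ G))
    (hC : LipschitzWith C (fderiv ℝ (fderiv ℝ G))) :
    ‖fderiv ℝ G (w + z) - fderiv ℝ G z - fderiv ℝ (fderiv ℝ G) z w‖ ≤ C * ‖w‖ ^ 2 := by
  have := (convex_closedBall z ‖w‖).norm_image_sub_le_of_norm_fderiv_le' (𝕜 := ℝ)
    (f := fderiv ℝ G) (φ := fderiv ℝ (fderiv ℝ G) z) (C := C * ‖w‖) (x := z) (y := w + z)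
    (fun x _ => hD1 x) (fun x hx => by
      have := hC.dist_le_mul x z
      rw [dist_eq_norm] at this
      refine this.trans ?_
      exact mul_le_mul_of_nonneg_left hx C.coe_nonneg) (mem_closedBall_self (norm_nonneg w))
    (by rw [mem_closedBall, dist_eq_norm, add_sub_cancel_right])
  rw [add_sub_cancel_right, mul_assoc, ← sq] at this
  exact this

/-- Second order Taylor expansion with a uniform cubic remainder. -/
theorem exists_taylor_bound {V : Type*} [NormedAddCommGroup V] [NormedSpace ℝ V] {G : V → ℝ}
    (hG : ContDiff ℝ 3 G) (hGc : HasCompactSupport G) :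
    ∃ C : ℝ, 0 ≤ C ∧ ∀ z v : V,
      |G (v + z) - G z - fderiv ℝ G z v - fderiv ℝ (fderiv ℝ G) z v v / 2| ≤ C * ‖v‖ ^ 3 := by
  obtain ⟨C, hC⟩ := exists_lipschitzWith_fderiv_fderiv hG hGc
  have h1 : ContDiff ℝ 2 (fderiv ℝ G) := hG.fderiv_right (by norm_num)
  have hD1 : Differentiable ℝ (fderiv ℝ G) := h1.differentiable (by norm_num)
  have hD0 : Differentiable ℝ G := hG.differentiable (by norm_num)
  exact ⟨C, C.coe_nonneg, fun z v => abs_taylor_le C.coe_nonneg (fun x => (hD0 x).hasFDerivAt)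
    (fun w => norm_fderiv_sub_le_of_lipschitzWith z w C hD1 hC) v⟩

variable {G : Space d → ℝ}

theorem abs_setIntegral_sub_le {C R : ℝ} {z : Space d} {E : Set (Space d)} (hG : Continuous G)
    (hC0 : 0 ≤ C)
    (hC : ∀ v : Space d,
      |G (v + z) - G z - fderiv ℝ G z v - fderiv ℝ (fderiv ℝ G) z v v / 2| ≤ C * ‖v‖ ^ 3)
    (hE : IsCubicSymmetric E) (hER : E ⊆ ball 0 R) (hd : d ≠ 0) :
    |(∫ v in E, G (v + z)) - volume.real E * G z -
      trace (fderiv ℝ (fderiv ℝ G) z) / (2 * d) * ∫ v in E, ‖v‖ ^ 2| ≤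
      C * R ^ 3 * volume.real E := by
  have hb : IsBounded E := isBounded_ball.subset hER
  have hint : ∀ f : Space d → ℝ, Continuous f → IntegrableOn f E := fun f hf =>
    integrableOn_of_isBounded hf hb
  have hE1 := hE.setIntegral_clm hb (fderiv ℝ G z)
  have hE2 := hE.setIntegral_bilinear hb (fderiv ℝ (fderiv ℝ G) z)
  have i1 : IntegrableOn (fun v => G (v + z)) E := hint _ (by fun_prop)
  have i2 : IntegrableOn (fun _ : Space d => G z) E := hint _ continuous_const
  have i3 : IntegrableOn (fun v => fderiv ℝ G z v) E := hint _ (by fun_prop)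
  have i4 : IntegrableOn (fun v => fderiv ℝ (fderiv ℝ G) z v v / 2) E := hint _ (by fun_prop)
  have key : (∫ v in E, G (v + z)) - volume.real E * G z -
      trace (fderiv ℝ (fderiv ℝ G) z) / (2 * d) * ∫ v in E, ‖v‖ ^ 2 =
      ∫ v in E, (G (v + z) - G z - fderiv ℝ G z v - fderiv ℝ (fderiv ℝ G) z v v / 2) := by
    have i12 : IntegrableOn (fun v => G (v + z) - G z) E := i1.sub i2
    have i123 : IntegrableOn (fun v => G (v + z) - G z - fderiv ℝ G z v) E := i12.sub i3
    rw [integral_sub i123 i4, integral_sub i12 i3, integral_sub i1 i2,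
      hE1, setIntegral_const, smul_eq_mul, integral_div]
    have : trace (fderiv ℝ (fderiv ℝ G) z) / (2 * d) * ∫ v in E, ‖v‖ ^ 2 =
        (∫ v in E, fderiv ℝ (fderiv ℝ G) z v v) / 2 := by
      have hd' : (d : ℝ) ≠ 0 := by exact_mod_cast hd
      field_simp
      linarith
    rw [this, sub_zero]
  rw [key, ← Real.norm_eq_abs]
  refine norm_setIntegral_le_of_norm_le_const hb.measure_lt_top fun v hv => ?_
  rw [Real.norm_eq_abs]
  have : ‖v‖ ≤ R := by simpa using (mem_ball.1 (hER hv)).le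
  exact (hC v).trans (by gcongr)

/-- A uniform bound on the Laplacian gives a gap of the symmetric means at all small scales. -/
theorem exists_hasSymmetricMeanGap {S : Set (Space d)} {K κ : ℝ} (hG : ContDiff ℝ 3 G)
    (hGc : HasCompactSupport G) (hd : d ≠ 0) (hK : 1 ≤ K) (hκ : 0 < κ)
    (hS : ∀ z ∈ S, trace (fderiv ℝ (fderiv ℝ G) z) / (2 * d) ≤ -κ) :
    ∀ ε > 0, ∃ r > 0, r ≤ ε ∧ ∃ γ > 0, ∀ z ∈ S, HasSymmetricMeanGap G z r (K * r) γ := by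
  intro ε hε
  obtain ⟨C, hC0, hC⟩ := exists_taylor_bound hG hGc
  have hCK : 0 ≤ C * K ^ 3 := by positivity
  -- The Laplacian gains at least `κ * r ^ 2` per unit of measure because `E` avoids the ball of
  -- radius `r`. The cubic remainder is at most `C * (K * r) ^ 3`, which this `r` keeps below half
  -- the gain.
  set r := min ε (κ / 2 / (C * K ^ 3 + 1)) with hr
  have hr0 : 0 < r := lt_min hε (by positivity)
  have hrC : C * K ^ 3 * r ≤ κ / 2 := by
    calc C * K ^ 3 * r ≤ C * K ^ 3 * (κ / 2 / (C * K ^ 3 + 1)) := by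
          gcongr; exact min_le_right _ _
      _ ≤ κ / 2 := by
        rw [mul_div_assoc', div_le_iff₀ (by positivity)]; nlinarith
  refine ⟨r, hr0, min_le_left _ _, κ / 2 * r ^ 2, by positivity, fun z hz E hEm hE hER => ?_⟩
  have hEb : IsBounded E := isBounded_ball.subset (hER.trans sdiff_subset)
  have h1 := (abs_le.1 (abs_setIntegral_sub_le hG.continuous hC0 (hC z) hE
    (hER.trans sdiff_subset) hd)).2
  have h2 : r ^ 2 * volume.real E ≤ ∫ v in E, ‖v‖ ^ 2 := by
    have := setIntegral_mono_on (integrableOn_const hEb.measure_lt_top.ne)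
      (integrableOn_of_isBounded (by fun_prop) hEb) hEm (f := fun _ => r ^ 2)
      (g := fun v : Space d => ‖v‖ ^ 2) (fun v hv => by
        have : r ≤ ‖v‖ := by simpa using (hER hv).2
        gcongr)
    rw [setIntegral_const, smul_eq_mul] at this
    linarith
  have hv : 0 ≤ volume.real E := measureReal_nonneg
  have h3 : trace (fderiv ℝ (fderiv ℝ G) z) / (2 * d) * ∫ v in E, ‖v‖ ^ 2 ≤
      -κ * (r ^ 2 * volume.real E) := by
    have h0 : 0 ≤ ∫ v in E, ‖v‖ ^ 2 := le_trans (by positivity) h2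
    nlinarith [hS z hz]
  have h4 : C * (K * r) ^ 3 * volume.real E ≤ κ / 2 * (r ^ 2 * volume.real E) := by
    calc C * (K * r) ^ 3 * volume.real E = (C * K ^ 3 * r) * (r ^ 2 * volume.real E) := by ring
      _ ≤ _ := by gcongr
  linarith

/-- The shell outside radius `r / 2` carries at least half of the volume. -/
theorem setIntegral_norm_sq_ball_ge {r : ℝ} (hr : 0 < r) (hd : d ≠ 0) :
    r ^ 2 / 8 * volume.real (ball (0 : Space d) r) ≤ ∫ v in ball (0 : Space d) r, ‖v‖ ^ 2 := by
  have hsub : ball (0 : Space d) (r / 2) ⊆ ball 0 r := ball_subset_ball (by linarith)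
  have hc : Continuous fun v : Space d => ‖v‖ ^ 2 := by fun_prop
  have e1 := setIntegral_eq_add_diff hc (isBounded_ball (x := (0 : Space d)) (r := r))
    (measurableSet_ball (x := (0 : Space d)) (ε := r / 2)) hsub
  have m1 := measureReal_eq_add_diff (isBounded_ball (x := (0 : Space d)) (r := r))
    (measurableSet_ball (x := (0 : Space d)) (ε := r / 2)) hsub
  set D := ball (0 : Space d) r \ ball 0 (r / 2)
  have hDb : IsBounded D := isBounded_ball.subset sdiff_subset
  have h2 : (r / 2) ^ 2 * volume.real D ≤ ∫ v in D, ‖v‖ ^ 2 := by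
    have := setIntegral_mono_on (integrableOn_const hDb.measure_lt_top.ne)
      (integrableOn_of_isBounded hc hDb) (measurableSet_ball.diff measurableSet_ball)
      (f := fun _ => (r / 2) ^ 2) (g := fun v : Space d => ‖v‖ ^ 2) (fun v hv => by
        have : r / 2 ≤ ‖v‖ := by simpa using hv.2
        gcongr)
    rw [setIntegral_const, smul_eq_mul] at this
    linarith
  have h3 : 0 ≤ ∫ v in ball (0 : Space d) (r / 2), ‖v‖ ^ 2 :=
    integral_nonneg fun v => by positivity
  have hm : volume.real (ball (0 : Space d) (r / 2)) ≤ volume.real (ball (0 : Space d) r) / 2 := by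
    rw [measureReal_ball _ hr, measureReal_ball _ (by positivity : 0 < r / 2), div_pow]
    have h2d : (2 : ℝ) ≤ 2 ^ d := le_self_pow₀ (by norm_num) hd
    have hp := measureReal_ball_pos (0 : Space d) one_pos
    rw [div_mul_eq_mul_div]
    gcongr
  have h5 : r ^ 2 * volume.real (ball (0 : Space d) (r / 2)) ≤
      r ^ 2 * (volume.real (ball (0 : Space d) r) / 2) := by gcongr
  nlinarith

/-- The Laplacian is controlled by the averages over small balls. -/
theorem trace_le_of_setIntegral_ball_le {κ : ℝ} {z : Space d} {ρ ε : ℕ → ℝ}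
    (hG : ContDiff ℝ 3 G) (hGc : HasCompactSupport G) (hd : d ≠ 0)
    (hρ : ∀ n, 0 < ρ n) (hρ0 : Tendsto ρ atTop (𝓝 0)) (hε0 : Tendsto ε atTop (𝓝 0))
    (hle : ∀ᶠ n in atTop, (∫ v in ball 0 (ρ n), G (v + z)) ≤
      volume.real (ball (0 : Space d) (ρ n)) * G z - κ * (∫ v in ball (0 : Space d) (ρ n), ‖v‖ ^ 2) +
        ε n * (ρ n) ^ 2 * volume.real (ball (0 : Space d) (ρ n))) :
    trace (fderiv ℝ (fderiv ℝ G) z) / (2 * d) ≤ -κ := by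
  obtain ⟨C, hC0, hC⟩ := exists_taylor_bound hG hGc
  by_contra! hlt
  set T := trace (fderiv ℝ (fderiv ℝ G) z) / (2 * d) + κ with hT
  have hT0 : 0 < T := by linarith
  have hlim : Tendsto (fun n => C * ρ n + ε n) atTop (𝓝 0) := by
    simpa using (hρ0.const_mul C).add hε0
  obtain ⟨n, hn, hn'⟩ := (hle.and (hlim.eventually_lt_const (by positivity : 0 < T / 8))).exists
  have h1 := (abs_le.1 (abs_setIntegral_sub_le hG.continuous hC0 (hC z)
    (isCubicSymmetric_ball (ρ n)) subset_rfl hd)).1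
  have h2 := setIntegral_norm_sq_ball_ge (d := d) (hρ n) hd
  set m := volume.real (ball (0 : Space d) (ρ n))
  set I := ∫ v in ball (0 : Space d) (ρ n), ‖v‖ ^ 2
  have hm : 0 < m := measureReal_ball_pos _ (hρ n)
  have hp : 0 < (ρ n) ^ 2 * m := mul_pos (pow_pos (hρ n) 2) hm
  have h3 : T * I ≤ (C * ρ n + ε n) * ((ρ n) ^ 2 * m) := by
    have e : T * I = trace (fderiv ℝ (fderiv ℝ G) z) / (2 * d) * I + κ * I := by rw [hT]; ring
    rw [e]
    nlinarith
  have h4 : T * ((ρ n) ^ 2 / 8 * m) ≤ T * I := by gcongr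
  nlinarith

end SmashSum

/-! ### Inf-convolution -/

namespace SmashSum

open Filter Set Metric Bornology

variable {d : ℕ}

/-- The inf-convolution of `t` over `K` with the quadratic kernel `N * ‖·‖ ^ 2`. -/
noncomputable def infConv (t : Space d → ℝ) (K : Set (Space d)) (N : ℝ) (x : Space d) : ℝ :=
  sInf ((fun y => t y + N * ‖x - y‖ ^ 2) '' K)

variable {t : Space d → ℝ} {K : Set (Space d)} {N m : ℝ}

theorem exists_infConv_eq (hK : IsCompact K) (hne : K.Nonempty) (ht : LowerSemicontinuousOn t K)
    (N : ℝ) (x : Space d) :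
    ∃ y ∈ K, infConv t K N x = t y + N * ‖x - y‖ ^ 2 ∧
      ∀ y' ∈ K, infConv t K N x ≤ t y' + N * ‖x - y'‖ ^ 2 := by
  have hlsc : LowerSemicontinuousOn (fun y => t y + N * ‖x - y‖ ^ 2) K :=
    ht.add ((by fun_prop : Continuous fun y : Space d => N * ‖x - y‖ ^ 2).lowerSemicontinuous.lowerSemicontinuousOn K)
  obtain ⟨y, hy, hmin⟩ := hlsc.exists_isMinOn hne hK
  have hl : IsLeast ((fun y => t y + N * ‖x - y‖ ^ 2) '' K) (t y + N * ‖x - y‖ ^ 2) := by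
    refine ⟨⟨y, hy, rfl⟩, ?_⟩
    rintro _ ⟨y', hy', rfl⟩
    exact hmin hy'
  refine ⟨y, hy, hl.csInf_eq, fun y' hy' => ?_⟩
  rw [infConv, hl.csInf_eq]
  exact hmin hy'

section

variable (hK : IsCompact K) (hne : K.Nonempty) (ht : LowerSemicontinuousOn t K)
include hK hne ht

theorem infConv_le (N : ℝ) (x : Space d) {y : Space d} (hy : y ∈ K) :
    infConv t K N x ≤ t y + N * ‖x - y‖ ^ 2 := by
  obtain ⟨_, _, _, h⟩ := exists_infConv_eq hK hne ht N x
  exact h y hy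

theorem infConv_le_self (N : ℝ) {x : Space d} (hx : x ∈ K) : infConv t K N x ≤ t x := by
  simpa using infConv_le hK hne ht N x hx

theorem neg_le_infConv (hN : 0 ≤ N) (hm : ∀ y ∈ K, |t y| ≤ m) (x : Space d) :
    -m ≤ infConv t K N x := by
  obtain ⟨y, hy, h, _⟩ := exists_infConv_eq hK hne ht N x
  have := (abs_le.1 (hm y hy)).1
  have : 0 ≤ N * ‖x - y‖ ^ 2 := by positivity
  linarith

/-- For `x` in a bounded set and `y ∈ K`, the functions `x ↦ N * ‖x - y‖ ^ 2` share a Lipschitz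
constant, which their minimum inherits. -/
theorem continuous_infConv (hN : 0 ≤ N) : Continuous (infConv t K N) := by
  obtain ⟨R, hR0, hR⟩ := hK.isBounded.subset_ball_lt 0 0
  refine LocallyLipschitz.continuous fun x₀ => ?_
  have hS : 0 ≤ 2 * N * (‖x₀‖ + 1 + R) := by positivity
  refine ⟨(2 * N * (‖x₀‖ + 1 + R)).toNNReal, ball x₀ 1, ball_mem_nhds _ one_pos,
    LipschitzOnWith.of_le_add_mul _ fun x hx x' hx' => ?_⟩
  obtain ⟨y, hy, h, _⟩ := exists_infConv_eq hK hne ht N x'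
  refine (infConv_le hK hne ht N x hy).trans ?_
  rw [h]
  have hyR : ‖y‖ ≤ R := by simpa using (mem_ball.1 (hR hy)).le
  have hb : ∀ w ∈ ball x₀ 1, ‖w - y‖ ≤ ‖x₀‖ + 1 + R := fun w hw => by
    have h1 : ‖w - x₀‖ ≤ 1 := by simpa [dist_eq_norm] using (mem_ball.1 hw).le
    calc ‖w - y‖ = ‖(w - x₀) + x₀ - y‖ := by congr 1; abel
      _ ≤ ‖w - x₀‖ + ‖x₀‖ + ‖y‖ := (norm_sub_le _ _).trans (by gcongr; exact norm_add_le _ _)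
      _ ≤ _ := by linarith
  have h1 : ‖x - y‖ ≤ ‖x' - y‖ + dist x x' := by
    rw [dist_eq_norm]
    calc ‖x - y‖ = ‖(x' - y) + (x - x')‖ := by congr 1; abel
      _ ≤ _ := norm_add_le _ _
  have h2 : ‖x - y‖ ^ 2 - ‖x' - y‖ ^ 2 ≤ 2 * (‖x₀‖ + 1 + R) * dist x x' := by
    have a := hb x hx
    have b := hb x' hx'
    have c := norm_nonneg (x - y)
    have c' := norm_nonneg (x' - y)
    have e := dist_nonneg (x := x) (y := x')
    calc ‖x - y‖ ^ 2 - ‖x' - y‖ ^ 2 = (‖x - y‖ - ‖x' - y‖) * (‖x - y‖ + ‖x' - y‖) := by ring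
      _ ≤ dist x x' * (‖x - y‖ + ‖x' - y‖) := by gcongr; linarith
      _ ≤ dist x x' * (2 * (‖x₀‖ + 1 + R)) := by gcongr; linarith
      _ = _ := by ring
  have h3 : N * (‖x - y‖ ^ 2 - ‖x' - y‖ ^ 2) ≤ N * (2 * (‖x₀‖ + 1 + R) * dist x x') := by gcongr
  rw [Real.coe_toNNReal _ hS]
  linarith

/-- Points of `K` have nearby minimizers. -/
theorem exists_infConv_eq_of_mem (hm : ∀ y ∈ K, |t y| ≤ m) {x : Space d}
    (hx : x ∈ K) :
    ∃ y ∈ K, infConv t K N x = t y + N * ‖x - y‖ ^ 2 ∧ N * ‖x - y‖ ^ 2 ≤ 2 * m := by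
  obtain ⟨y, hy, h, _⟩ := exists_infConv_eq hK hne ht N x
  have h1 := infConv_le_self hK hne ht N hx
  have h2 := (abs_le.1 (hm y hy)).1
  have h3 := (abs_le.1 (hm x hx)).2
  exact ⟨y, hy, h, by linarith⟩

theorem tendsto_infConv (hm : ∀ y ∈ K, |t y| ≤ m) {x : Space d} (hx : x ∈ K) {N : ℕ → ℝ}
    (hN0 : Tendsto N atTop atTop) :
    Tendsto (fun n => infConv t K (N n) x) atTop (𝓝 (t x)) := by
  have hm0 : 0 ≤ m := (abs_nonneg _).trans (hm x hx)
  refine tendsto_order.2 ⟨fun a ha => ?_, fun a ha => Eventually.of_forall fun n =>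
    (infConv_le_self hK hne ht _ hx).trans_lt ha⟩
  -- The upper bound was immediate. The lower one holds because minimizers converge to `x` as `N`
  -- grows and `t` is lower semicontinuous there.
  have h1 := ht x hx a ha
  obtain ⟨ε, hε, hball⟩ := mem_nhdsWithin_iff.1 h1
  have h2 : ∀ᶠ n in atTop, 2 * m / ε ^ 2 + 1 ≤ N n := hN0.eventually_ge_atTop _
  filter_upwards [h2] with n hn
  obtain ⟨y, hy, he, hle⟩ := exists_infConv_eq_of_mem (N := N n) hK hne ht hm hx
  have hNn : 0 < N n := lt_of_lt_of_le (by positivity) hn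
  have hyε : ‖x - y‖ < ε := by
    by_contra! hge
    have : N n * ε ^ 2 ≤ 2 * m := le_trans (by gcongr) hle
    have h3 : 2 * m / ε ^ 2 * ε ^ 2 = 2 * m := by field_simp
    nlinarith [pow_pos hε 2]
  have hya : a < t y := hball ⟨by rwa [mem_ball, dist_comm, dist_eq_norm], hy⟩
  rw [he]
  have : 0 ≤ N n * ‖x - y‖ ^ 2 := by positivity
  linarith

/-- Freezing the minimizer `y` at `x` gives a quadratic polynomial that touches from above. Its
linear part integrates to zero over the ball. -/
theorem setIntegral_infConv_sub_le (hN : 0 ≤ N) {r : ℝ} (x : Space d) :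
    ∫ v in ball (0 : Space d) r, (infConv t K N (v + x) - infConv t K N x) ≤
      N * r ^ 2 * volume.real (ball (0 : Space d) r) := by
  obtain ⟨y, hy, h, _⟩ := exists_infConv_eq hK hne ht N x
  have hc := continuous_infConv hK hne ht hN
  have hint : ∀ f : Space d → ℝ, Continuous f → IntegrableOn f (ball (0 : Space d) r) :=
    fun f hf => integrableOn_of_isBounded hf isBounded_ball
  have hle : ∀ v ∈ ball (0 : Space d) r, infConv t K N (v + x) - infConv t K N x ≤
      ((2 * N) • innerSL ℝ (x - y)) v + N * r ^ 2 := by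
    intro v hv
    have h1 := infConv_le hK hne ht N (v + x) hy
    have hv' : ‖v‖ ≤ r := by simpa using (mem_ball.1 hv).le
    have e : ‖v + x - y‖ ^ 2 = ‖v‖ ^ 2 + 2 * inner ℝ (x - y) v + ‖x - y‖ ^ 2 := by
      rw [add_sub_assoc, norm_add_sq_real, real_inner_comm]
    rw [e] at h1
    have h2 : N * ‖v‖ ^ 2 ≤ N * r ^ 2 := by gcongr
    simp only [smul_apply, innerSL_apply_apply, smul_eq_mul]
    linarith
  have := setIntegral_mono_on (hint _ (by fun_prop)) (hint _ (by fun_prop)) measurableSet_ball hle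
  rw [integral_add (hint _ (by fun_prop)) (hint _ (by fun_prop)),
    (isCubicSymmetric_ball r).setIntegral_clm isBounded_ball, setIntegral_const, smul_eq_mul] at this
  linarith

/-- Moving the minimizer along with the point, from `y` to `v + y`, bounds the increments at `x` by
those of `t` at `y`. The mean value inequality of `t` at `y` is therefore inherited at `x`. -/
theorem eventually_setIntegral_infConv_sub_le (hN : 0 ≤ N)
    (hti : IntegrableOn t K) {x y : Space d} (hyK : y ∈ interior K)
    (hy : infConv t K N x = t y + N * ‖x - y‖ ^ 2)
    (hmean : ∀ᶠ r : ℝ in 𝓝[>] 0, ∫ v in ball (0 : Space d) r, t (v + y) ≤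
      volume.real (ball (0 : Space d) r) * t y) :
    ∀ᶠ r : ℝ in 𝓝[>] 0,
      ∫ v in ball (0 : Space d) r, (infConv t K N (v + x) - infConv t K N x) ≤ 0 := by
  obtain ⟨ε, hε, hball⟩ := Metric.mem_nhds_iff.1 (mem_interior_iff_mem_nhds.1 hyK)
  have hlt : ∀ᶠ r : ℝ in 𝓝[>] 0, r < ε := nhdsWithin_le_nhds (Iio_mem_nhds hε)
  have hc := continuous_infConv hK hne ht hN
  filter_upwards [hmean, hlt] with r hr hrε
  have hint : ∀ f : Space d → ℝ, Continuous f → IntegrableOn f (ball (0 : Space d) r) :=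
    fun f hf => integrableOn_of_isBounded hf isBounded_ball
  have hpre : (fun v => v + y) ⁻¹' ball y r = ball (0 : Space d) r := by
    rw [preimage_add_right_ball, sub_self]
  have hti' : IntegrableOn (fun v => t (v + y)) (ball (0 : Space d) r) := by
    have h1 : IntegrableOn t (ball y r) := hti.mono_set ((ball_subset_ball hrε.le).trans hball)
    have h2 := ((measurePreserving_add_right volume y).integrableOn_comp_preimage
      (measurableEmbedding_addRight y)).2 h1
    rwa [hpre] at h2
  have hle : ∀ v ∈ ball (0 : Space d) r, infConv t K N (v + x) - infConv t K N x ≤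
      t (v + y) - t y := by
    intro v hv
    have hvy : v + y ∈ K := hball (ball_subset_ball hrε.le (by
      rw [← hpre] at hv
      exact hv))
    have h1 := infConv_le hK hne ht N (v + x) hvy
    rw [add_sub_add_left_eq_sub] at h1
    rw [hy]
    linarith
  have := setIntegral_mono_on (hint _ (by fun_prop)) (g := fun v => t (v + y) - t y)
    (hti'.sub (hint _ continuous_const)) measurableSet_ball hle
  rw [integral_sub hti' (hint _ continuous_const), setIntegral_const, smul_eq_mul] at this
  linarith

end

end SmashSum

/-! ### Mollification -/

namespace SmashSum

open Filter Set Metric Bornology ContinuousLinearMap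
open scoped Convolution

variable {d : ℕ}

/-- The integral over a ball of the increments of a function. -/
noncomputable def ballIncrement (u : Space d → ℝ) (r : ℝ) (x : Space d) : ℝ :=
  ∫ v in ball (0 : Space d) r, (u (v + x) - u x)

theorem stronglyMeasurable_ballIncrement {u : Space d → ℝ} (hu : Continuous u) (r : ℝ) :
    StronglyMeasurable (ballIncrement u r) := by
  have : Continuous (Function.uncurry fun (x v : Space d) => u (v + x) - u x) := by
    unfold Function.uncurry; fun_prop
  exact this.stronglyMeasurable.integral_prod_right

/-- Fubini: the ball increment of a mollification is the mollification of the ball increments. -/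
theorem setIntegral_ball_convolution {ψ q : Space d → ℝ} (hψ : Continuous ψ)
    (hψc : HasCompactSupport ψ) (hq : Continuous q) (hqc : HasCompactSupport q) (r : ℝ)
    (z : Space d) :
    (∫ v in ball (0 : Space d) r, (ψ ⋆[lsmul ℝ ℝ, volume] q) (v + z)) -
        volume.real (ball (0 : Space d) r) * (ψ ⋆[lsmul ℝ ℝ, volume] q) z =
      ∫ y, ψ y * ballIncrement q r (z - y) ∧
    Integrable fun y => ψ y * ballIncrement q r (z - y) := by
  have hF : Continuous (Function.uncurry fun v y : Space d => ψ y * q (v + z - y)) := by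
    unfold Function.uncurry; fun_prop
  obtain ⟨a, ha⟩ := hψc.isCompact.isBounded.subset_closedBall (0 : Space d)
  obtain ⟨b, hb⟩ := hqc.isCompact.isBounded.subset_closedBall (0 : Space d)
  have hFc : HasCompactSupport (Function.uncurry fun v y : Space d => ψ y * q (v + z - y)) := by
    refine HasCompactSupport.intro ((isCompact_closedBall (0 : Space d) (b + ‖z‖ + a)).prod
      (isCompact_closedBall (0 : Space d) a)) ?_
    rintro ⟨v, y⟩ hvy
    by_contra hne
    simp only [Function.uncurry] at hne
    have h1 : ‖y‖ ≤ a := by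
      simpa using ha (subset_tsupport _ (left_ne_zero_of_mul hne))
    have h2 : ‖v + z - y‖ ≤ b := by
      simpa using hb (subset_tsupport _ (right_ne_zero_of_mul hne))
    refine hvy ⟨?_, by simpa using h1⟩
    have : v = (v + z - y) - z + y := by abel
    rw [mem_closedBall, dist_zero_right, this]
    calc _ ≤ ‖v + z - y‖ + ‖z‖ + ‖y‖ := (norm_add_le _ _).trans (by gcongr; exact norm_sub_le _ _)
      _ ≤ _ := by linarith
  have hFi : Integrable (Function.uncurry fun v y : Space d => ψ y * q (v + z - y))
      ((volume.restrict (ball (0 : Space d) r)).prod volume) :=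
    hF.integrable_of_hasCompactSupport hFc
  have hswap := integral_integral_swap hFi
  have hint : ∀ f : Space d → ℝ, Continuous f → IntegrableOn f (ball (0 : Space d) r) :=
    fun f hf => integrableOn_of_isBounded hf isBounded_ball
  have hψq : ∀ x : Space d, Integrable fun y => ψ y * q (x - y) := fun x =>
    Continuous.integrable_of_hasCompactSupport (by fun_prop) hψc.mul_right
  have hconv : ∀ x, (ψ ⋆[lsmul ℝ ℝ, volume] q) x = ∫ y, ψ y * q (x - y) := fun x => by
    simp [convolution_def]
  have hinc : ∀ y, ψ y * ballIncrement q r (z - y) =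
      (∫ v in ball (0 : Space d) r, ψ y * q (v + z - y)) -
        volume.real (ball (0 : Space d) r) * (ψ y * q (z - y)) := fun y => by
    rw [ballIncrement, integral_sub (hint _ (by fun_prop)) (hint _ (by fun_prop)),
      setIntegral_const, smul_eq_mul, integral_const_mul]
    simp only [add_sub_assoc]
    ring
  have i1 : Integrable fun y => ∫ v in ball (0 : Space d) r, ψ y * q (v + z - y) :=
    hFi.integral_prod_right
  constructor
  · simp_rw [hinc, hconv]
    rw [integral_sub i1 ((hψq z).const_mul _), integral_const_mul, hswap]
  · simp_rw [hinc]
    exact i1.sub ((hψq z).const_mul _)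

/-- Mollification preserves superharmonicity, in the form of a bound on the Laplacian. -/
theorem trace_convolution_le {q u : Space d → ℝ} {κ N : ℝ} {z : Space d}
    (φ : ContDiffBump (0 : Space d)) (hd : d ≠ 0) (hq : Continuous q) (hqc : HasCompactSupport q)
    (hu : Continuous u) (hqu : ∀ w ∈ ball z (φ.rOut + 1), q w = u w - κ * ‖w‖ ^ 2)
    (hinc : ∀ x, ∀ r > 0, ballIncrement u r x ≤ N * r ^ 2 * volume.real (ball (0 : Space d) r))
    (hev : ∀ x ∈ ball z φ.rOut, ∀ᶠ r : ℝ in 𝓝[>] 0, ballIncrement u r x ≤ 0) :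
    trace (fderiv ℝ (fderiv ℝ (φ.normed volume ⋆[lsmul ℝ ℝ, volume] q)) z) / (2 * d) ≤ -κ := by
  set ψ := φ.normed volume with hψd
  have hψ : Continuous ψ := φ.continuous_normed
  have hψc : HasCompactSupport ψ := φ.hasCompactSupport_normed
  have hψ0 : ∀ y, 0 ≤ ψ y := φ.nonneg_normed
  have hψ1 : ∫ y, ψ y = 1 := φ.integral_normed
  have hψi : Integrable ψ := hψ.integrable_of_hasCompactSupport hψc
  have hψs : ∀ y, ψ y ≠ 0 → z - y ∈ ball z φ.rOut := fun y hy => by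
    have : y ∈ Function.support ψ := hy
    rw [hψd, φ.support_normed_eq] at this
    simpa using this
  set ρ : ℕ → ℝ := fun n => 1 / ((n : ℝ) + 1) with hρd
  have hρ : ∀ n, 0 < ρ n := fun n => Nat.one_div_pos_of_nat
  have hρ1 : ∀ n, ρ n ≤ 1 := fun n => by
    rw [hρd, div_le_one (by positivity)]; linarith [(Nat.cast_nonneg n : (0 : ℝ) ≤ n)]
  have hρ0 : Tendsto ρ atTop (𝓝 0) := tendsto_one_div_add_atTop_nhds_zero_nat
  have hρ0' : Tendsto ρ atTop (𝓝[>] 0) :=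
    tendsto_nhdsWithin_iff.2 ⟨hρ0, Eventually.of_forall hρ⟩
  set V : ℕ → ℝ := fun n => volume.real (ball (0 : Space d) (ρ n)) with hVd
  have hV : ∀ n, 0 < V n := fun n => measureReal_ball_pos _ (hρ n)
  -- The positive part of the increment, in units of `ρ² V`. It vanishes eventually at each relevant
  -- point, though not uniformly, and `hinc` dominates it, so its integral tends to `0`.
  set e : ℕ → Space d → ℝ :=
    fun n y => ψ y * (max (ballIncrement u (ρ n) (z - y)) 0 / ((ρ n) ^ 2 * V n)) with hed
  have hden : ∀ n, 0 < (ρ n) ^ 2 * V n := fun n => mul_pos (pow_pos (hρ n) 2) (hV n)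
  have hN : 0 ≤ max N 0 := le_max_right _ _
  have hem : ∀ n, AEStronglyMeasurable (e n) volume := fun n => by
    have h1 : StronglyMeasurable fun y => ballIncrement u (ρ n) (z - y) :=
      (stronglyMeasurable_ballIncrement hu _).comp_measurable (measurable_const.sub measurable_id)
    exact (hψ.stronglyMeasurable.mul ((h1.sup stronglyMeasurable_const).div
      stronglyMeasurable_const)).aestronglyMeasurable
  have heb : ∀ n y, ‖e n y‖ ≤ ψ y * max N 0 := fun n y => by
    have h0 : 0 ≤ max (ballIncrement u (ρ n) (z - y)) 0 / ((ρ n) ^ 2 * V n) :=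
      div_nonneg (le_max_right _ _) (hden n).le
    rw [Real.norm_of_nonneg (mul_nonneg (hψ0 y) h0)]
    refine mul_le_mul_of_nonneg_left ?_ (hψ0 y)
    rw [div_le_iff₀ (hden n)]
    refine max_le ?_ (mul_nonneg hN (hden n).le)
    calc _ ≤ N * (ρ n) ^ 2 * V n := hinc _ _ (hρ n)
      _ = N * ((ρ n) ^ 2 * V n) := by ring
      _ ≤ _ := mul_le_mul_of_nonneg_right (le_max_left _ _) (hden n).le
  have hei : ∀ n, Integrable (e n) := fun n =>
    (hψi.mul_const (max N 0)).mono' (hem n) (Eventually.of_forall (heb n))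
  have hlim : Tendsto (fun n => ∫ y, e n y) atTop (𝓝 0) := by
    have : Tendsto (fun n => ∫ y, e n y) atTop (𝓝 (∫ _ : Space d, (0 : ℝ))) := by
      refine tendsto_integral_of_dominated_convergence (fun y => ψ y * max N 0) hem
        (hψi.mul_const _) (fun n => Eventually.of_forall (heb n))
        (Eventually.of_forall fun y => ?_)
      by_cases hy : ψ y = 0
      · simp [hed, hy]
      · refine tendsto_const_nhds.congr' ?_
        filter_upwards [hρ0'.eventually (hev _ (hψs y hy))] with n hn
        simp [hed, max_eq_right hn]
    simpa using this
  refine trace_le_of_setIntegral_ball_le (ρ := ρ) (ε := fun n => ∫ y, e n y)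
    (hψc.contDiff_convolution_left _ φ.contDiff_normed hq.locallyIntegrable)
    (hψc.convolution _ hqc) hd hρ hρ0 hlim (Eventually.of_forall fun n => ?_)
  obtain ⟨h1, h2⟩ := setIntegral_ball_convolution hψ hψc hq hqc (ρ n) z
  set I := ∫ v in ball (0 : Space d) (ρ n), ‖v‖ ^ 2 with hI
  have hpt : ∀ y, ψ y * ballIncrement q (ρ n) (z - y) ≤
      e n y * ((ρ n) ^ 2 * V n) - ψ y * (κ * I) := by
    intro y
    have he : e n y * ((ρ n) ^ 2 * V n) = ψ y * max (ballIncrement u (ρ n) (z - y)) 0 := by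
      rw [hed]
      field_simp [(hden n).ne', (hρ n).ne', (hV n).ne']
    rw [he, ← mul_sub]
    by_cases hy : ψ y = 0
    · simp [hy]
    refine mul_le_mul_of_nonneg_left ?_ (hψ0 y)
    have hx := hψs y hy
    set x := z - y
    have hint : ∀ f : Space d → ℝ, Continuous f → IntegrableOn f (ball (0 : Space d) (ρ n)) :=
      fun f hf => integrableOn_of_isBounded hf isBounded_ball
    -- The cross term in the expansion of `‖v + x‖ ^ 2` is linear in `v` and integrates to zero.
    have hbi : ballIncrement q (ρ n) x = ballIncrement u (ρ n) x - κ * I := by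
      have hpt : ∀ v ∈ ball (0 : Space d) (ρ n), q (v + x) - q x =
          (u (v + x) - u x) - ((κ * 2) • innerSL ℝ x) v - κ * ‖v‖ ^ 2 := by
        intro v hv
        have hv1 : ‖v‖ < 1 := lt_of_lt_of_le (by simpa using hv) (hρ1 n)
        rw [hqu x (ball_subset_ball (by linarith) hx), hqu (v + x), norm_add_sq_real,
          real_inner_comm]
        · simp only [smul_apply, innerSL_apply_apply, smul_eq_mul]
          ring
        · rw [mem_ball, dist_eq_norm] at hx ⊢
          calc ‖v + x - z‖ = ‖v + (x - z)‖ := by rw [add_sub_assoc]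
            _ ≤ ‖v‖ + ‖x - z‖ := norm_add_le _ _
            _ < φ.rOut + 1 := by linarith
      rw [ballIncrement, setIntegral_congr_fun measurableSet_ball hpt,
        integral_sub (hint _ (by fun_prop)) (hint _ (by fun_prop)),
        integral_sub (hint _ (by fun_prop)) (hint _ (by fun_prop)),
        (isCubicSymmetric_ball _).setIntegral_clm isBounded_ball, integral_const_mul, sub_zero,
        ballIncrement]
    rw [hbi]
    linarith [le_max_left (ballIncrement u (ρ n) x) 0]
  have h3 := integral_mono h2 (((hei n).mul_const _).sub (hψi.mul_const _)) hpt
  have h4 : ∫ y, (e n y * ((ρ n) ^ 2 * V n) - ψ y * (κ * I)) =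
      (∫ y, e n y) * ((ρ n) ^ 2 * V n) - κ * I := by
    rw [integral_sub ((hei n).mul_const _) (hψi.mul_const _), integral_mul_const,
      integral_mul_const, hψ1, one_mul]
  have h3' := h3.trans_eq h4
  rw [← h1] at h3'
  linarith

end SmashSum

/-! ### From smooth to lower semicontinuous functions -/

namespace SmashSum

open Filter Set Metric Bornology ContinuousLinearMap
open scoped Convolution

variable {d : ℕ} {op : Set (Space d) → Set (Space d) → Set (Space d)} {Ω : Set (Space d)}

/-- The quadrature inequality passes to dominated limits. -/
theorem setIntegral_le_add_of_tendsto {S W X : Set (Space d)} (hWS : W ⊆ S) (hXS : X ⊆ S)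
    {f : ℕ → Space d → ℝ} {f' F : Space d → ℝ}
    (hfm : ∀ n, AEStronglyMeasurable (f n) (volume.restrict S)) (hF : IntegrableOn F S)
    (hfF : ∀ n, ∀ᵐ x ∂volume.restrict S, ‖f n x‖ ≤ F x)
    (hlim : ∀ᵐ x ∂volume.restrict S, Tendsto (fun n => f n x) atTop (𝓝 (f' x)))
    (hle : ∀ n, ∫ x in S, f n x ≤ (∫ x in W, f n x) + ∫ x in X, f n x) :
    ∫ x in S, f' x ≤ (∫ x in W, f' x) + ∫ x in X, f' x := by
  have key : ∀ T ⊆ S, Tendsto (fun n => ∫ x in T, f n x) atTop (𝓝 (∫ x in T, f' x)) := by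
    intro T hT
    have hr := Measure.restrict_mono_set volume hT
    exact tendsto_integral_of_dominated_convergence F (fun n => (hfm n).mono_measure hr)
      (hF.mono_set hT) (fun n => ae_mono hr (hfF n)) (ae_mono hr hlim)
  exact le_of_tendsto_of_tendsto' (key S subset_rfl) ((key W hWS).add (key X hXS)) hle

namespace IsSmash

variable (h : IsSmash op)
include h

/-- The quadrature inequality for a continuous function that is strictly superharmonic near `Ω`. -/
theorem setIntegral_le_of_ballIncrement_le {u : Space d → ℝ} {κ N η : ℝ} (hd : d ≠ 0)
    (hΩ : IsBounded Ω) (hu : Continuous u) (hκ : 0 < κ) (hη : 0 < η)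
    (hinc : ∀ x, ∀ r > 0, ballIncrement u r x ≤ N * r ^ 2 * volume.real (ball (0 : Space d) r))
    (hev : ∀ z ∈ closure Ω, ∀ x ∈ ball z η, ∀ᶠ r : ℝ in 𝓝[>] 0, ballIncrement u r x ≤ 0)
    {W X : Set (Space d)} (hW : IsBddOpen W) (hX : IsBddOpen X) (hs : op W X ≤ᵐ[volume] Ω) :
    ∫ x in op W X, (u x - κ * ‖x‖ ^ 2) ≤
      (∫ x in W, (u x - κ * ‖x‖ ^ 2)) + ∫ x in X, (u x - κ * ‖x‖ ^ 2) := by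
  obtain ⟨K, hK1, hK⟩ := h.exists_op_ball_subset
  obtain ⟨R, hR0, hR⟩ := hΩ.subset_ball_lt 0 0
  have hcl : ∀ z ∈ closure Ω, ‖z‖ ≤ R := fun z hz => by
    have := closure_minimal (hR.trans ball_subset_closedBall) isClosed_closedBall hz
    simpa using this
  -- The cutoff must be `1` on balls of radius `rOut + 1 ≤ 2` about points of norm at most `R`.
  let χ : ContDiffBump (0 : Space d) := ⟨R + 3, R + 4, by linarith, by linarith⟩
  set q : Space d → ℝ := fun x => χ x * (u x - κ * ‖x‖ ^ 2) with hq
  have hqc : Continuous q := χ.continuous.mul (by fun_prop)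
  have hqs : HasCompactSupport q := χ.hasCompactSupport.mul_right
  have hqu : ∀ w ∈ ball (0 : Space d) (R + 3), q w = u w - κ * ‖w‖ ^ 2 := fun w hw => by
    rw [hq]
    simp only
    rw [χ.one_of_mem_closedBall (ball_subset_closedBall hw), one_mul]
  obtain ⟨B, hB⟩ := hqs.exists_bound_of_continuous hqc
  set a : ℕ → ℝ := fun n => min η 1 / ((n : ℝ) + 1) with ha
  have hm : 0 < min η 1 := lt_min hη one_pos
  have ha0 : ∀ n, 0 < a n := fun n => div_pos hm (by positivity)
  have ham : ∀ n, a n ≤ min η 1 := fun n =>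
    div_le_self hm.le (by linarith [(Nat.cast_nonneg n : (0 : ℝ) ≤ n)])
  let φ : ℕ → ContDiffBump (0 : Space d) := fun n =>
    ⟨a n / 2, a n, half_pos (ha0 n), half_lt_self (ha0 n)⟩
  have hφ : ∀ n, (φ n).rOut = a n := fun _ => rfl
  have hφ0 : Tendsto (fun n => (φ n).rOut) atTop (𝓝 0) := by
    have := (tendsto_one_div_add_atTop_nhds_zero_nat (𝕜 := ℝ)).const_mul (min η 1)
    rw [mul_zero] at this
    refine this.congr fun n => ?_
    rw [hφ, ha]; ring
  set G : ℕ → Space d → ℝ := fun n => (φ n).normed volume ⋆[lsmul ℝ ℝ, volume] q with hG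
  have hGd : ∀ n, ContDiff ℝ 3 (G n) := fun n =>
    (φ n).hasCompactSupport_normed.contDiff_convolution_left _ (φ n).contDiff_normed
      hqc.locallyIntegrable
  have hGc : ∀ n, HasCompactSupport (G n) := fun n =>
    (φ n).hasCompactSupport_normed.convolution _ hqs
  have hGb : ∀ n x, ‖G n x‖ ≤ 3 * B := fun n x => by
    have h1 : dist (G n x) (q x) ≤ 2 * B := by
      refine (φ n).dist_normed_convolution_le hqc.aestronglyMeasurable fun y _ => ?_
      rw [dist_eq_norm]
      exact (norm_sub_le _ _).trans (by linarith [hB y, hB x])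
    have h2 : ‖G n x‖ ≤ dist (G n x) (q x) + ‖q x‖ := by
      rw [dist_eq_norm]
      calc ‖G n x‖ = ‖(G n x - q x) + q x‖ := by congr 1; ring
        _ ≤ _ := norm_add_le _ _
    linarith [hB x]
  have hGq : ∀ n, QuadratureUpTo op (G n) Ω 0 := by
    intro n
    obtain ⟨Λ, hΛ⟩ := (hGd n).lipschitzWith_of_hasCompactSupport (hGc n) (by norm_num)
    refine h.quadratureUpTo_zero (b := 3 * B) (Λ := Λ) (hGb n) (fun x y => hΛ.dist_le_mul x y)
      hK1 hK ?_
    refine exists_hasSymmetricMeanGap (hGd n) (hGc n) hd hK1 hκ fun z hz => ?_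
    refine trace_convolution_le (φ n) hd hqc hqs hu (fun w hw => hqu w ?_) hinc
      (fun x hx => hev z hz x ?_)
    · rw [mem_ball, dist_zero_right]
      have h1 : ‖w - z‖ < a n + 1 := by simpa [dist_eq_norm, hφ] using hw
      have h2 : ‖w‖ ≤ ‖w - z‖ + ‖z‖ := by
        calc ‖w‖ = ‖(w - z) + z‖ := by congr 1; abel
          _ ≤ _ := norm_add_le _ _
      linarith [hcl z hz, ham n, min_le_right η 1]
    · exact ball_subset_ball ((ham n).trans (min_le_left _ _)) hx
  have hS := h.isBddOpen hW hX
  refine setIntegral_le_add_of_tendsto (f := G) (F := fun _ => 3 * B) (h.subset_left hW hX)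
    (h.subset_right hW hX) (fun n => (hGd n).continuous.aestronglyMeasurable)
    (integrableOn_const hS.ne_top) (fun n => Eventually.of_forall (hGb n)) ?_ (fun n => ?_)
  · rw [ae_restrict_iff' hS.measurableSet]
    filter_upwards [hs] with x hx hxS
    rw [← hqu x (ball_subset_ball (by linarith) (hR (hx hxS)))]
    exact ContDiffBump.convolution_tendsto_right_of_continuous hφ0 hqc x
  · simpa using hGq n W X hW hX hs

/-- The quadrature inequality for a bounded lower semicontinuous function that is superharmonic
on a neighbourhood of `Ω`. -/
theorem setIntegral_le_of_lowerSemicontinuousOn {t : Space d → ℝ} {δ m : ℝ} (hd : d ≠ 0)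
    (hΩ : IsBounded Ω) (hδ : 0 < δ) (hlsc : LowerSemicontinuousOn t (cthickening δ Ω))
    (hm : ∀ x ∈ cthickening δ Ω, |t x| ≤ m) (hti : IntegrableOn t (cthickening δ Ω))
    (hmean : ∀ y ∈ interior (cthickening δ Ω), ∀ᶠ r : ℝ in 𝓝[>] 0,
      ∫ v in ball (0 : Space d) r, t (v + y) ≤ volume.real (ball (0 : Space d) r) * t y)
    {W X : Set (Space d)} (hW : IsBddOpen W) (hX : IsBddOpen X) (hs : op W X ≤ᵐ[volume] Ω) :
    ∫ x in op W X, t x ≤ (∫ x in W, t x) + ∫ x in X, t x := by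
  have hS := h.isBddOpen hW hX
  rcases Ω.eq_empty_or_nonempty with rfl | hne
  · have h0 : volume (op W X) = 0 := by
      rw [← ae_eq_empty]
      exact hs.antisymm (Eventually.of_forall fun x hx => hx.elim)
    have hz : ∀ T ⊆ op W X, ∫ x in T, t x = 0 := fun T hT =>
      setIntegral_measure_zero _ (measure_mono_null hT h0)
    rw [hz _ subset_rfl, hz _ (h.subset_left hW hX), hz _ (h.subset_right hW hX), add_zero]
  set K := cthickening δ Ω with hKd
  have hK : IsCompact K := isCompact_of_isClosed_isBounded isClosed_cthickening hΩ.cthickening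
  have hΩK : Ω ⊆ K := self_subset_cthickening Ω
  have hKne : K.Nonempty := hne.mono hΩK
  obtain ⟨R, hR0, hR⟩ := hΩ.subset_ball_lt 0 0
  have hm0 : 0 ≤ m := (abs_nonneg _).trans (hm _ hKne.some_mem)
  -- The offset forces minimizers to lie within `δ / 4` of points of `K` for every `n`.
  set N : ℕ → ℝ := fun n => n + (2 * m / (δ / 4) ^ 2 + 1) with hN
  have hN1 : ∀ n, 2 * m / (δ / 4) ^ 2 + 1 ≤ N n := fun n => by
    rw [hN]; linarith [(Nat.cast_nonneg n : (0 : ℝ) ≤ n)]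
  have hN0 : ∀ n, 0 < N n := fun n => lt_of_lt_of_le (by positivity) (hN1 n)
  have hNt : Tendsto N atTop atTop :=
    tendsto_atTop_add_const_right _ _ tendsto_natCast_atTop_atTop
  set κ : ℕ → ℝ := fun n => 1 / ((n : ℝ) + 1) with hκ
  have hκ0 : ∀ n, 0 < κ n := fun n => Nat.one_div_pos_of_nat
  have hκ1 : ∀ n, κ n ≤ 1 := fun n => by
    rw [hκ, div_le_one (by positivity)]; linarith [(Nat.cast_nonneg n : (0 : ℝ) ≤ n)]
  have hκt : Tendsto κ atTop (𝓝 0) := tendsto_one_div_add_atTop_nhds_zero_nat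
  set u : ℕ → Space d → ℝ := fun n => infConv t K (N n) with hu
  have huc : ∀ n, Continuous (u n) := fun n => continuous_infConv hK hKne hlsc (hN0 n).le
  have hub : ∀ n, ∀ x ∈ K, |u n x| ≤ m := fun n x hx => abs_le.2
    ⟨neg_le_infConv hK hKne hlsc (hN0 n).le hm x,
      (infConv_le_self hK hKne hlsc _ hx).trans (abs_le.1 (hm x hx)).2⟩
  have hstep : ∀ n, ∫ x in op W X, (u n x - κ n * ‖x‖ ^ 2) ≤
      (∫ x in W, (u n x - κ n * ‖x‖ ^ 2)) + ∫ x in X, (u n x - κ n * ‖x‖ ^ 2) := by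
    intro n
    refine h.setIntegral_le_of_ballIncrement_le (N := N n) (η := δ / 4) hd hΩ (huc n) (hκ0 n)
      (by positivity) (fun x r _ => setIntegral_infConv_sub_le hK hKne hlsc (hN0 n).le x)
      (fun z hz x hx => ?_) hW hX hs
    have hxc : x ∈ cthickening (δ / 4) Ω := by
      rw [← cthickening_closure]
      exact closedBall_subset_cthickening hz _ (ball_subset_closedBall hx)
    have hxK : x ∈ K := cthickening_mono (by linarith) _ hxc
    obtain ⟨y, hyK, hy, hyle⟩ := exists_infConv_eq_of_mem (N := N n) hK hKne hlsc hm hxK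
    have hxy : ‖x - y‖ ≤ δ / 4 := by
      by_contra! hlt
      have h1 : N n * (δ / 4) ^ 2 ≤ 2 * m :=
        le_trans (mul_le_mul_of_nonneg_left (by gcongr) (hN0 n).le) hyle
      have h2 : (2 * m / (δ / 4) ^ 2 + 1) * (δ / 4) ^ 2 ≤ N n * (δ / 4) ^ 2 := by
        gcongr; exact hN1 n
      have h3 : 2 * m / (δ / 4) ^ 2 * (δ / 4) ^ 2 = 2 * m := by field_simp
      nlinarith [pow_pos hδ 2]
    -- `x` is within `δ / 4` of `Ω` and `y` within `δ / 4` of `x`, so a further `δ / 4` about `y`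
    -- still fits into `K`.
    have hyi : y ∈ interior K := by
      refine mem_interior_iff_mem_nhds.2 (mem_of_superset (closedBall_mem_nhds y
        (by positivity : 0 < δ / 4)) fun w hw => ?_)
      have h1 : w ∈ closedBall x (δ / 2) := by
        rw [mem_closedBall] at hw ⊢
        have : dist y x ≤ δ / 4 := by rwa [dist_comm, dist_eq_norm]
        linarith [dist_triangle w y x]
      have h2 := cthickening_cthickening_subset (by positivity : 0 ≤ δ / 2)
        (by positivity : 0 ≤ δ / 4) Ω (closedBall_subset_cthickening hxc _ h1)
      exact cthickening_mono (by linarith) _ h2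
    exact eventually_setIntegral_infConv_sub_le hK hKne hlsc (hN0 n).le hti hyi hy (hmean y hyi)
  have hae : ∀ᵐ x ∂volume.restrict (op W X), x ∈ Ω := by
    rw [ae_restrict_iff' hS.measurableSet]
    exact hs
  refine setIntegral_le_add_of_tendsto (f := fun n x => u n x - κ n * ‖x‖ ^ 2)
    (F := fun _ => m + R ^ 2) (h.subset_left hW hX)
    (h.subset_right hW hX) (fun n => Continuous.aestronglyMeasurable (by fun_prop))
    (integrableOn_const hS.ne_top) (fun n => ?_) ?_ hstep
  · filter_upwards [hae] with x hx
    have hxR : ‖x‖ ≤ R := by simpa using (mem_ball.1 (hR hx)).le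
    have h1 : κ n * ‖x‖ ^ 2 ≤ 1 * R ^ 2 := by gcongr; exact hκ1 n
    have h2 : 0 ≤ κ n * ‖x‖ ^ 2 := mul_nonneg (hκ0 n).le (by positivity)
    have h3 := abs_le.1 (hub n x (hΩK hx))
    rw [Real.norm_eq_abs]
    exact abs_le.2 ⟨by linarith [h3.1], by linarith [h3.2, sq_nonneg R]⟩
  · filter_upwards [hae] with x hx
    have h1 := tendsto_infConv hK hKne hlsc hm (hΩK hx) hNt
    simpa using h1.sub (hκt.mul_const (‖x‖ ^ 2))

end IsSmash

end SmashSum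

/-! ### Truncation, erosion and the general superharmonic function -/

namespace SmashSum

open Filter Set Metric Bornology

variable {d : ℕ} {op : Set (Space d) → Set (Space d) → Set (Space d)} {Ω : Set (Space d)}
  {s : Space d → EReal}

/-- The truncation of `s` from above at height `k`, as a real function. -/
noncomputable def truncate (s : Space d → EReal) (k : ℝ) (x : Space d) : ℝ :=
  (min (s x) k).toReal

namespace IsSuperharmonicOn

variable (hs : IsSuperharmonicOn s Ω)
include hs

theorem coe_truncate (k : ℝ) {x : Space d} (hx : x ∈ Ω) :
    (truncate s k x : EReal) = min (s x) k := by
  refine EReal.coe_toReal ?_ ?_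
  · exact ((min_le_right _ _).trans_lt (EReal.coe_lt_top k)).ne
  · exact (lt_min (bot_lt_iff_ne_bot.2 (hs.ne_bot x hx)) (EReal.bot_lt_coe k)).ne'

/-- Finiteness matters: where `s x = ⊤` the truncation is `k`, whereas `toReal` sends `⊤` to `0`. -/
theorem truncate_eq_min (k : ℝ) {x : Space d} (hx : x ∈ Ω) (hx' : s x ≠ ⊤) :
    truncate s k x = min (s x).toReal k := by
  rw [← EReal.coe_eq_coe_iff, hs.coe_truncate k hx, ← EReal.coe_toReal hx' (hs.ne_bot x hx)]
  rw [EReal.toReal_coe]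
  rcases le_total (s x).toReal k with h | h
  · rw [min_eq_left h, min_eq_left (EReal.coe_le_coe_iff.2 h)]
  · rw [min_eq_right h, min_eq_right (EReal.coe_le_coe_iff.2 h)]

theorem truncate_le (k : ℝ) {x : Space d} (hx : x ∈ Ω) : truncate s k x ≤ k := by
  rw [← EReal.coe_le_coe_iff, hs.coe_truncate k hx]
  exact min_le_right _ _

theorem lowerSemicontinuousOn_truncate (k : ℝ) : LowerSemicontinuousOn (truncate s k) Ω := by
  intro x hx a ha
  have h1 : (a : EReal) < min (s x) k := by
    rw [← hs.coe_truncate k hx]; exact_mod_cast ha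
  filter_upwards [hs.lowerSemicontinuousOn x hx a (lt_min_iff.1 h1).1, self_mem_nhdsWithin]
    with y hy hyΩ
  rw [gt_iff_lt, ← EReal.coe_lt_coe_iff, hs.coe_truncate k hyΩ]
  exact lt_min hy (lt_min_iff.1 h1).2

theorem exists_abs_truncate_le (k : ℝ) {K : Set (Space d)} (hK : IsCompact K) (hKΩ : K ⊆ Ω) :
    ∃ m, ∀ x ∈ K, |truncate s k x| ≤ m := by
  rcases K.eq_empty_or_nonempty with rfl | hne
  · exact ⟨0, by simp⟩
  obtain ⟨y, hy, hmin⟩ := ((hs.lowerSemicontinuousOn_truncate k).mono hKΩ).exists_isMinOn hne hK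
  refine ⟨max k (-truncate s k y), fun x hx => abs_le.2 ⟨?_, ?_⟩⟩
  · have h1 : truncate s k y ≤ truncate s k x := hmin hx
    linarith [le_max_right k (-truncate s k y)]
  · exact (hs.truncate_le k (hKΩ hx)).trans (le_max_left _ _)

theorem truncate_ae_eq (hΩ : MeasurableSet Ω) (k : ℝ) :
    ∀ᵐ x ∂volume.restrict Ω, truncate s k x = min (s x).toReal k := by
  filter_upwards [hs.ae_ne_top, ae_restrict_mem hΩ] with x hx hxΩ
  exact hs.truncate_eq_min k hxΩ hx

theorem integrableOn_truncate (hΩ : MeasurableSet Ω) (k : ℝ) {K : Set (Space d)}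
    (hf : volume K ≠ ⊤) (hKi : IntegrableOn (fun x => (s x).toReal) K) (hKΩ : K ⊆ Ω) :
    IntegrableOn (truncate s k) K := by
  have h1 : IntegrableOn (fun x => min (s x).toReal k) K := hKi.inf (integrableOn_const hf)
  refine h1.congr ?_
  filter_upwards [ae_mono (Measure.restrict_mono_set volume hKΩ) (hs.truncate_ae_eq hΩ k)]
    with x hx
  exact hx.symm

/-- The average of the truncation is at most the average of `s`, hence at most `s y`, and it is at
most `k`. -/
theorem eventually_setIntegral_truncate_le (hΩ : IsOpen Ω) (k : ℝ) {y : Space d} (hy : y ∈ Ω) :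
    ∀ᶠ r : ℝ in 𝓝[>] 0, ∫ v in ball (0 : Space d) r, truncate s k (v + y) ≤
      volume.real (ball (0 : Space d) r) * truncate s k y := by
  obtain ⟨ε, hε, hball⟩ := nhds_basis_closedBall.mem_iff.1 (hΩ.mem_nhds hy)
  have hlt : ∀ᶠ r : ℝ in 𝓝[>] 0, r < ε := nhdsWithin_le_nhds (Iio_mem_nhds hε)
  filter_upwards [hs.average_le y hy, hlt, self_mem_nhdsWithin] with r hr hrε hr0
  have hr0 : 0 < r := hr0
  have hpre : (fun v => v + y) ⁻¹' ball y r = ball (0 : Space d) r := by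
    rw [preimage_add_right_ball, sub_self]
  have htr : ∫ v in ball (0 : Space d) r, truncate s k (v + y) = ∫ x in ball y r, truncate s k x := by
    rw [← hpre]
    exact (measurePreserving_add_right volume y).setIntegral_preimage_emb
      (measurableEmbedding_addRight y) _ _
  have hsub : ball y r ⊆ Ω := ((ball_subset_ball hrε.le).trans ball_subset_closedBall).trans hball
  have hsi : IntegrableOn (fun x => (s x).toReal) (ball y r) :=
    (hs.locallyIntegrableOn.integrableOn_compact_subset hball (isCompact_closedBall y ε)).mono_set
      ((ball_subset_ball hrε.le).trans ball_subset_closedBall)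
  have hti := hs.integrableOn_truncate hΩ.measurableSet k (isBddOpen_ball y r).ne_top hsi hsub
  have hae := ae_mono (Measure.restrict_mono_set volume hsub) (hs.truncate_ae_eq hΩ.measurableSet k)
  have hV : volume.real (ball (0 : Space d) r) = volume.real (ball y r) := by
    simp only [Measure.real, Measure.addHaar_ball_center volume y r]
  set V := volume.real (ball y r) with hVd
  have hV0 : 0 < V := measureReal_ball_pos y hr0
  have h1 : ∫ x in ball y r, truncate s k x ≤ ∫ x in ball y r, (s x).toReal := by
    refine integral_mono_ae hti hsi ?_
    filter_upwards [hae] with x hx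
    rw [hx]
    exact min_le_left _ _
  have h2 : ∫ x in ball y r, truncate s k x ≤ V * k := by
    have := setIntegral_mono_on hti (integrableOn_const (isBddOpen_ball y r).ne_top)
      measurableSet_ball (g := fun _ => k) fun x hx => hs.truncate_le k (hsub hx)
    rwa [setIntegral_const, smul_eq_mul] at this
  rw [htr, hV]
  rw [setAverage_eq, smul_eq_mul, ← hVd] at hr
  have h3 : (((∫ x in ball y r, truncate s k x) / V : ℝ) : EReal) ≤ truncate s k y := by
    rw [hs.coe_truncate k hy]
    refine le_min (le_trans (EReal.coe_le_coe_iff.2 ?_) hr) (EReal.coe_le_coe_iff.2 ?_)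
    · rw [div_eq_inv_mul]
      exact mul_le_mul_of_nonneg_left h1 (inv_nonneg.2 hV0.le)
    · rw [div_le_iff₀ hV0, mul_comm]
      exact h2
  rw [EReal.coe_le_coe_iff, div_le_iff₀ hV0, mul_comm] at h3
  exact h3

end IsSuperharmonicOn

/-- The points at distance more than `δ` from the complement of `A`. -/
def erosion (A : Set (Space d)) (δ : ℝ) : Set (Space d) :=
  {x | ENNReal.ofReal δ < infEDist x Aᶜ}

theorem isOpen_erosion (A : Set (Space d)) (δ : ℝ) : IsOpen (erosion A δ) :=
  isOpen_lt continuous_const continuous_infEDist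

theorem add_mem_of_mem_erosion {A : Set (Space d)} {δ : ℝ} {x v : Space d}
    (hx : x ∈ erosion A δ) (hv : ‖v‖ ≤ δ) : x + v ∈ A := by
  by_contra hn
  have h1 : infEDist x Aᶜ ≤ edist x (x + v) := infEDist_le_edist_of_mem hn
  have h2 : edist x (x + v) ≤ ENNReal.ofReal δ := by
    rw [edist_dist, dist_self_add_right]
    exact ENNReal.ofReal_le_ofReal hv
  exact (h1.trans h2).not_gt hx

theorem erosion_subset (A : Set (Space d)) {δ : ℝ} (hδ : 0 ≤ δ) : erosion A δ ⊆ A := fun x hx => by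
  simpa using add_mem_of_mem_erosion (v := 0) hx (by simpa using hδ)

theorem erosion_anti (A : Set (Space d)) {δ δ' : ℝ} (h : δ ≤ δ') : erosion A δ' ⊆ erosion A δ :=
  fun _ hx => (ENNReal.ofReal_le_ofReal h).trans_lt hx

theorem iUnion_erosion {A : Set (Space d)} (hA : IsOpen A) {δ : ℕ → ℝ} (hδ : ∀ n, 0 ≤ δ n)
    (hδ0 : Tendsto δ atTop (𝓝 0)) : ⋃ n, erosion A (δ n) = A := by
  refine Subset.antisymm (iUnion_subset fun n => erosion_subset A (hδ n)) fun x hx => ?_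
  have h0 : 0 < infEDist x Aᶜ := by
    rw [infEDist_pos_iff_notMem_closure, hA.isClosed_compl.closure_eq]
    simpa using hx
  have h1 : Tendsto (fun n => ENNReal.ofReal (δ n)) atTop (𝓝 0) := by
    simpa using ENNReal.tendsto_ofReal hδ0
  obtain ⟨n, hn⟩ := (h1.eventually_lt_const h0).exists
  exact mem_iUnion.2 ⟨n, hn⟩

theorem IsBddOpen.erosion {A : Set (Space d)} (hA : IsBddOpen A) {δ : ℝ} (hδ : 0 ≤ δ) :
    IsBddOpen (erosion A δ) :=
  ⟨isOpen_erosion A δ, hA.isBounded.subset (erosion_subset A hδ)⟩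

namespace IsSmash

variable (h : IsSmash op) {A B : Set (Space d)}
include h

/-- There is no sum of open sets in dimension zero. -/
theorem dim_ne_zero : d ≠ 0 := by
  rintro rfl
  have hu : IsBddOpen (univ : Set (Space 0)) := ⟨isOpen_univ, (Set.toFinite _).isBounded⟩
  have h1 := h.measure hu hu
  have h2 : volume (op univ univ) ≤ volume (univ : Set (Space 0)) := measure_mono (subset_univ _)
  rw [h1] at h2
  have h3 : 0 < volume (univ : Set (Space 0)) := isOpen_univ.measure_pos volume univ_nonempty
  exact (ENNReal.lt_add_right hu.ne_top h3.ne').not_ge h2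

/-- Translates of the eroded sets by vectors of length at most `δ` stay in `A` and `B`. By
translation invariance and monotonicity, the corresponding translates of their sum stay in `op A B`.
-/
theorem cthickening_op_erosion_subset (hA : IsBddOpen A) (hB : IsBddOpen B) {δ : ℝ} (hδ : 0 < δ) :
    cthickening (δ / 2) (op (erosion A δ) (erosion B δ)) ⊆ op A B := by
  have hA' := hA.erosion hδ.le
  have hB' := hB.erosion hδ.le
  intro x hx
  obtain ⟨z, hz, hxz⟩ := mem_thickening_iff.1
    (cthickening_subset_thickening' hδ (half_lt_self hδ) _ hx)
  rw [dist_eq_norm] at hxz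
  have himg : ∀ C : Set (Space d), IsBddOpen C → (fun a => a + (x - z)) '' erosion C δ ⊆ C := by
    rintro C _ _ ⟨a, ha, rfl⟩
    exact add_mem_of_mem_erosion ha hxz.le
  have hopen : ∀ C : Set (Space d), IsBddOpen C →
      IsBddOpen ((fun a => a + (x - z)) '' erosion C δ) := fun C hC =>
    ⟨(Homeomorph.addRight (x - z)).isOpenMap _ (isOpen_erosion C δ),
      hC.isBounded.subset (himg C hC)⟩
  have ht := h.six.translation _ _ (x - z) hA'.1 hA'.2 hB'.1 hB'.2
  refine h.mono (hopen A hA) hA (hopen B hB) hB (himg A hA) (himg B hB) ?_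
  rw [ht]
  exact ⟨z, hz, by simp⟩

theorem setIntegral_op_erosion_le (hA : IsBddOpen A) (hB : IsBddOpen B)
    (hs : IsSuperharmonicOn s (op A B)) (hsi : IntegrableOn (fun x => (s x).toReal) (op A B))
    {δ : ℝ} (hδ : 0 < δ) :
    ∫ x in op (erosion A δ) (erosion B δ), (s x).toReal ≤
      (∫ x in erosion A δ, (s x).toReal) + ∫ x in erosion B δ, (s x).toReal := by
  have hA' := hA.erosion hδ.le
  have hB' := hB.erosion hδ.le
  have hO := h.isBddOpen hA hB
  have hO' := h.isBddOpen hA' hB'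
  have hsub := h.mono hA' hA hB' hB (erosion_subset A hδ.le) (erosion_subset B hδ.le)
  have hr := Measure.restrict_mono_set volume hsub
  set K := cthickening (δ / 2) (op (erosion A δ) (erosion B δ)) with hKd
  have hKO : K ⊆ op A B := h.cthickening_op_erosion_subset hA hB hδ
  have hK : IsCompact K := isCompact_of_isClosed_isBounded isClosed_cthickening
    hO'.isBounded.cthickening
  have hstep : ∀ k : ℕ, ∫ x in op (erosion A δ) (erosion B δ), truncate s k x ≤
      (∫ x in erosion A δ, truncate s k x) + ∫ x in erosion B δ, truncate s k x := by
    intro k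
    obtain ⟨m, hm⟩ := hs.exists_abs_truncate_le k hK hKO
    exact h.setIntegral_le_of_lowerSemicontinuousOn h.dim_ne_zero hO'.isBounded (half_pos hδ)
      ((hs.lowerSemicontinuousOn_truncate k).mono hKO) hm
      (hs.integrableOn_truncate hO.measurableSet k hK.measure_lt_top.ne (hsi.mono_set hKO) hKO)
      (fun y hy => hs.eventually_setIntegral_truncate_le hO.isOpen k (hKO (interior_subset hy)))
      hA' hB' Filter.EventuallyLE.rfl
  have hae : ∀ᵐ x ∂volume.restrict (op (erosion A δ) (erosion B δ)), ∀ k : ℕ,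
      truncate s k x = min (s x).toReal k :=
    ae_all_iff.2 fun k => ae_mono hr (hs.truncate_ae_eq hO.measurableSet k)
  refine setIntegral_le_add_of_tendsto (f := fun k : ℕ => truncate s k)
    (F := fun x => ‖(s x).toReal‖) (h.subset_left hA' hB') (h.subset_right hA' hB')
    (fun k => (hs.integrableOn_truncate hO.measurableSet k hO'.ne_top (hsi.mono_set hsub)
      hsub).aestronglyMeasurable)
    (hsi.mono_set hsub).norm (fun k => ?_) ?_ hstep
  · filter_upwards [hae] with x hx
    rw [hx k, Real.norm_eq_abs, Real.norm_eq_abs]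
    refine abs_le.2 ⟨le_min (neg_abs_le _) ?_, (min_le_left _ _).trans (le_abs_self _)⟩
    linarith [abs_nonneg (s x).toReal, (Nat.cast_nonneg k : (0 : ℝ) ≤ k)]
  · filter_upwards [hae] with x hx
    refine tendsto_const_nhds.congr' ?_
    filter_upwards [eventually_ge_atTop ⌈(s x).toReal⌉₊] with k hk
    rw [hx k, min_eq_left ((Nat.le_ceil _).trans (Nat.cast_le.2 hk))]

theorem setIntegral_op_le_add (hA : IsBddOpen A) (hB : IsBddOpen B)
    (hs : IsSuperharmonicOn s (op A B)) (hsi : IntegrableOn (fun x => (s x).toReal) (op A B)) :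
    ∫ x in op A B, (s x).toReal ≤ (∫ x in A, (s x).toReal) + ∫ x in B, (s x).toReal := by
  set δ : ℕ → ℝ := fun n => 1 / ((n : ℝ) + 1) with hδd
  have hδ : ∀ n, 0 < δ n := fun n => Nat.one_div_pos_of_nat
  have hδ0 : Tendsto δ atTop (𝓝 0) := tendsto_one_div_add_atTop_nhds_zero_nat
  have hanti : Antitone δ := fun m n hmn => by
    simp only [hδd]
    gcongr
  have hmono : ∀ C : Set (Space d), Monotone fun n => erosion C (δ n) := fun C m n hmn =>
    erosion_anti C (hanti hmn)
  have hA' := fun n => hA.erosion (hδ n).le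
  have hB' := fun n => hB.erosion (hδ n).le
  have hO := h.isBddOpen hA hB
  have hO' := fun n => h.isBddOpen (hA' n) (hB' n)
  have hOmono : Monotone fun n => op (erosion A (δ n)) (erosion B (δ n)) := fun m n hmn =>
    h.mono (hA' m) (hA' n) (hB' m) (hB' n) (hmono A hmn) (hmono B hmn)
  have hOsub : (⋃ n, op (erosion A (δ n)) (erosion B (δ n))) ⊆ op A B := iUnion_subset fun n =>
    h.mono (hA' n) hA (hB' n) hB (erosion_subset A (hδ n).le) (erosion_subset B (hδ n).le)
  have hUA := iUnion_erosion hA.isOpen (fun n => (hδ n).le) hδ0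
  have hUB := iUnion_erosion hB.isOpen (fun n => (hδ n).le) hδ0
  -- Continuity from below is not an axiom. It follows from conservation, as the measures of the
  -- eroded sums tend to `volume A + volume B`.
  have hOae : (⋃ n, op (erosion A (δ n)) (erosion B (δ n)) : Set (Space d)) =ᵐ[volume] op A B := by
    have hU : IsBddOpen (⋃ n, op (erosion A (δ n)) (erosion B (δ n))) :=
      ⟨isOpen_iUnion fun n => (hO' n).isOpen, hO.isBounded.subset hOsub⟩
    refine hU.ae_eq_of_subset hO hOsub ?_
    rw [h.measure hA hB]
    have lA := tendsto_measure_iUnion_atTop (μ := volume) (hmono A)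
    have lB := tendsto_measure_iUnion_atTop (μ := volume) (hmono B)
    rw [hUA] at lA
    rw [hUB] at lB
    refine le_of_tendsto' (lA.add lB) fun n => ?_
    simp only [Function.comp]
    rw [← h.measure (hA' n) (hB' n)]
    exact measure_mono (subset_iUnion (fun n => op (erosion A (δ n)) (erosion B (δ n))) n)
  have hsA := hsi.mono_set (h.subset_left hA hB)
  have hsB := hsi.mono_set (h.subset_right hA hB)
  have tO := tendsto_setIntegral_of_monotone (μ := volume) (f := fun x => (s x).toReal)
    (fun n => (hO' n).measurableSet) hOmono (hsi.mono_set hOsub)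
  have tA := tendsto_setIntegral_of_monotone (μ := volume) (f := fun x => (s x).toReal)
    (fun n => (hA' n).measurableSet) (hmono A) (by rw [hUA]; exact hsA)
  have tB := tendsto_setIntegral_of_monotone (μ := volume) (f := fun x => (s x).toReal)
    (fun n => (hB' n).measurableSet) (hmono B) (by rw [hUB]; exact hsB)
  rw [setIntegral_congr_set hOae] at tO
  rw [hUA] at tA
  rw [hUB] at tB
  exact le_of_tendsto_of_tendsto' tO (tA.add tB) fun n =>
    h.setIntegral_op_erosion_le hA hB hs hsi (hδ n)

theorem isQuadratureDomain_op (hA : IsBddOpen A) (hB : IsBddOpen B) :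
    IsQuadratureDomain
      (fun x => A.indicator (fun _ => (1 : ℝ)) x + B.indicator (fun _ => (1 : ℝ)) x)
      (op A B) := by
  refine ⟨h.isOpen hA hB, ?_, fun s hs hsi => ?_⟩
  · have : {x | 0 < A.indicator (fun _ => (1 : ℝ)) x + B.indicator (fun _ => (1 : ℝ)) x} \
        op A B = ∅ := by
      refine sdiff_eq_empty.2 fun x hx => ?_
      by_contra hn
      have h1 : x ∉ A := fun hxA => hn (h.subset_left hA hB hxA)
      have h2 : x ∉ B := fun hxB => hn (h.subset_right hA hB hxB)
      simp [h1, h2] at hx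
    rw [this, measure_empty]
  · refine (h.setIntegral_op_le_add hA hB hs hsi).trans_eq ?_
    have hpt : ∀ x, (s x).toReal *
        (A.indicator (fun _ => (1 : ℝ)) x + B.indicator (fun _ => (1 : ℝ)) x) =
        A.indicator (fun x => (s x).toReal) x + B.indicator (fun x => (s x).toReal) x := fun x => by
      by_cases h1 : x ∈ A <;> by_cases h2 : x ∈ B <;> simp [h1, h2, mul_add]
    simp_rw [hpt]
    rw [integral_add (hsi.indicator hA.measurableSet) (hsi.indicator hB.measurableSet),
      setIntegral_indicator hA.measurableSet, setIntegral_indicator hB.measurableSet,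
      inter_eq_self_of_subset_right (h.subset_left hA hB),
      inter_eq_self_of_subset_right (h.subset_right hA hB)]

end IsSmash

end SmashSum

theorem mainTheorem3 (d : ℕ)
    (op : Set (SmashSum.Space d) → Set (SmashSum.Space d) → Set (SmashSum.Space d))
    (hop : SmashSum.IsSumOfOpenSets op)
    (hsix : SmashSum.SatisfiesSixRequirements op)
    (hbulky : SmashSum.IsBulkySum op)
    (A B : Set (SmashSum.Space d))
    (hA : IsOpen A) (hAb : Bornology.IsBounded A)
    (hB : IsOpen B) (hBb : Bornology.IsBounded B) :
    (∀ s : SmashSum.Space d → EReal, SmashSum.IsSuperharmonicOn s (op A B) →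
      IntegrableOn (fun x => (s x).toReal) (op A B) volume →
      ∫ x in op A B, (s x).toReal ≤ (∫ x in A, (s x).toReal) + ∫ x in B, (s x).toReal) ∧
    SmashSum.IsQuadratureDomain
      (fun x => A.indicator (fun _ => (1 : ℝ)) x + B.indicator (fun _ => (1 : ℝ)) x)
      (op A B) := by
  have h : SmashSum.IsSmash op := ⟨hop, hsix⟩
  exact ⟨fun s hs hsi => h.setIntegral_op_le_add ⟨hA, hAb⟩ ⟨hB, hBb⟩ hs hsi,
    h.isQuadratureDomain_op ⟨hA, hAb⟩ ⟨hB, hBb⟩⟩
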